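/- Let $k\ge 2$ and $n\ge k$ be fixed, and let $\varepsilon_1,\dots,\varepsilon_k\in(0,1)$ with $\sum_{i=1}^k\varepsilon_i=1$ be independent of $d$. For each dimension $d$ let $\Pi_1,\dots,\Pi_k$ be probability distributions on $\mathbb{R}^d$ with finite second moments, mean vectors $\mu_i$ and covariance matrices $\Sigma_i$ (all depending on $d$). Put $\mu_{i,j}=\mu_i-\mu_j$, $\Delta_{i,j}=\|\mu_{i,j}\|^2$ and $\Delta_{\min}=\min_{1\le i<j\le k}\Delta_{i,j}$, and assume $\Delta_{\min}>0$ for all large $d$. Assume that, as $d\to\infty$, (2) $\max_{i}\mathrm{tr}(\Sigma_i^2)/\Delta_{\min}^2\to 0$; (3) $\max_{i}\mathrm{Var}(\|x-\mu_i\|^2\mid x\in\Pi_i)/\Delta_{\min}^2\to 0$ (the variances being finite for large $d$); (4) $\{\mathrm{tr}(\Sigma_i)-\mathrm{tr}(\Sigma_j)\}/\Delta_{\min}\to 0$ for all $1\le i<j\le k$; (5) $\mathrm{Angle}(\mu_{i,i+1},\mu_{j,j+1})\to\pi/2$ and $\Delta_{j,j+1}/\Delta_{i,i+1}\to 0$ for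 all $1\le i<j\le k-1$; (6) $\max_{1\le i\le k-2,\ 1\le j\le k}\mu_{i,i+1}^T\Sigma_j\mu_{i,i+1}/\Delta_{\min}^2\to 0$ (void if $k=2$). For each $d$ let $x_1,\dots,x_n$ be independently drawn from the mixture $\sum_{i=1}^k\varepsilon_i\Pi_i$, i.e. each $x_j$ carries an unobserved label, equal to $i$ with probability $\varepsilon_i$, given which $x_j$ has law $\Pi_i$ (written $x_j\in\Pi_i$). Let $\mu$ and $\Sigma$ be the mean vector and covariance matrix of the mixture, $\lambda_1\ge\dots\ge\lambda_d\ge0$ the eigenvalues of $\Sigma$ with orthonormal eigenvectors $h_1,\dots,h_d$, signs chosen so that $h_i^T\mu_{i,i+1}\ge 0$ for $i=1,\dots,k-1$, and $z_{ij}=h_i^T(x_j-\mu)/\lambda_i^{1/2}$. Let $\bar x=n^{-1}\sum_j x_j$ and let $S_D$ be the $n\times n$ dual sample covariance matrix with entries $(x_j-\bar x)^T(x_{j'}-\bar x)/(n-1)$. Let $\hat u_i=(\hat u_{i1},\dots,\hat u_{in})^T$ be orthonormal eigenvectors of $S_D$ belonging to its eigenvalues in decreasing order, signs chosen so that $\sum_{j}\hat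 u_{ij}z_{ij}\ge 0$ for $i=1,\dots,k-1$, and let $\hat z_{ij}=n^{1/2}\hat u_{ij}$. Fix the labels of the $n$ observations (independently of $d$); let $n_i$ be the number of $j$ with $x_j\in\Pi_i$, $\eta_i=n_i/n$, $\eta_{(0)}=0$ and $\eta_{(i)}=\sum_{m=1}^i\eta_m$. If $n_i>0$ for all $i=1,\dots,k$, then, conditionally on these labels, for all $i=1,\dots,k-1$ and $j=1,\dots,n$, as $d\to\infty$ with $n$ fixed, $\hat z_{ij}$ converges in probability to $$\begin{cases}0 & \text{if } i\ge2 \text{ and } x_j\in\Pi_1\cup\dots\cup\Pi_{i-1},\\[1mm] \sqrt{(1-\eta_{(i)})/\{\eta_i(1-\eta_{(i-1)})\}} & \text{if } x_j\in\Pi_i,\\[1mm] -\sqrt{\eta_i/\{(1-\eta_{(i)})(1-\eta_{(i-1)})\}} & \text{if } x_j\in\Pi_{i+1}\cup\dots\cup\Pi_k.\end{cases}$$ -/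

import Mathlib

open MeasureTheory ProbabilityTheory Filter Topology
open scoped RealInnerProductSpace

/-- Column vectors in `ℝᵖ`, with the Euclidean inner product and norm. -/
abbrev Vec (p : ℕ) := EuclideanSpace ℝ (Fin p)

section Populations

variable {d : ℕ}

/-- Mean vector of a distribution on `ℝᵈ`. -/
noncomputable def meanVec (ν : Measure (Vec d)) : Vec d := ∫ x, x ∂ν

/-- Covariance matrix of a distribution on `ℝᵈ`. -/
noncomputable def covMat (ν : Measure (Vec d)) : Matrix (Fin d) (Fin d) ℝ :=
  Matrix.of fun a b => cov[fun x : Vec d => x a, fun x : Vec d => x b; ν]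

/-- The mixture `∑ i, ε i • Pop i` of the populations `Pop i` with proportions `ε i`. -/
noncomputable def mixture {k : ℕ} (ε : Fin k → ℝ) (Pop : Fin k → Measure (Vec d)) :
    Measure (Vec d) :=
  ∑ i, ENNReal.ofReal (ε i) • Pop i

/-- `Δ_{i,j}`: the squared Euclidean distance of the mean vectors of populations `i` and `j`. -/
noncomputable def meanGap {k : ℕ} (Pop : Fin k → Measure (Vec d)) (i j : Fin k) : ℝ :=
  ‖meanVec (Pop i) - meanVec (Pop j)‖ ^ 2

/-- `Δ_min`: the minimum of `Δ_{i,j}` over all pairs `i < j`. -/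
noncomputable def minGap {k : ℕ} (Pop : Fin k → Measure (Vec d)) : ℝ :=
  ⨅ p : {p : Fin k × Fin k // p.1 < p.2}, meanGap Pop p.1.1 p.1.2

/-- The difference of the mean vectors of two consecutive populations; there are `m + 1`
populations and the consecutive pairs are indexed by `Fin m`. -/
noncomputable def stepVec {m : ℕ} (Pop : Fin (m + 1) → Measure (Vec d)) (i : Fin m) : Vec d :=
  meanVec (Pop i.castSucc) - meanVec (Pop i.succ)

end Populations

section Conditions

variable {m : ℕ} (Pop : (d : ℕ) → Fin (m + 1) → Measure (Vec d))

/-- `max_i tr(Σ_i²) / Δ_min² → 0`. -/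
def TraceSqCondition : Prop :=
  Tendsto (fun d => (⨆ i, (covMat (Pop d i) * covMat (Pop d i)).trace) / minGap (Pop d) ^ 2)
    atTop (𝓝 0)

/-- `max_i Var(‖x - μ_i‖² | x ∈ Π_i) / Δ_min² → 0`, the variances being finite for large `d`. -/
def NormVarianceCondition : Prop :=
  (∀ᶠ d in atTop, ∀ i, MemLp (fun x => ‖x - meanVec (Pop d i)‖ ^ 2) 2 (Pop d i)) ∧
  Tendsto (fun d => (⨆ i, Var[fun x => ‖x - meanVec (Pop d i)‖ ^ 2; Pop d i])
    / minGap (Pop d) ^ 2) atTop (𝓝 0)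

/-- `(tr(Σ_i) - tr(Σ_j)) / Δ_min → 0` for all `i < j`. -/
def TraceCondition : Prop :=
  ∀ i j, i < j → Tendsto
    (fun d => ((covMat (Pop d i)).trace - (covMat (Pop d j)).trace) / minGap (Pop d))
    atTop (𝓝 0)

/-- Consecutive mean differences are asymptotically orthogonal and of decreasing order. -/
def MeanStepCondition : Prop :=
  ∀ i j : Fin m, i < j →
    Tendsto (fun d => InnerProductGeometry.angle (stepVec (Pop d) i) (stepVec (Pop d) j))
      atTop (𝓝 (Real.pi / 2)) ∧
    Tendsto (fun d => meanGap (Pop d) j.castSucc j.succ / meanGap (Pop d) i.castSucc i.succ)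
      atTop (𝓝 0)

/-- `max (μ_{i,i+1}ᵀ Σ_j μ_{i,i+1}) / Δ_min² → 0`, the maximum being over all populations `j` and
all consecutive pairs `(i, i + 1)` except the last one (it is void, with value `0`, when there
are two populations). -/
def StepVarianceCondition : Prop :=
  Tendsto (fun d =>
    (⨆ q : {i : Fin m // (i : ℕ) + 1 < m} × Fin (m + 1),
      (stepVec (Pop d) q.1.1).ofLp ⬝ᵥ
        (covMat (Pop d q.2)).mulVec (stepVec (Pop d) q.1.1).ofLp) / minGap (Pop d) ^ 2)
    atTop (𝓝 0)

end Conditions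

/-- An independent labelled sample from the mixture: `Y j` is the (unobserved) population from
which the observation `X j` is drawn. -/
structure IsMixtureSample {Ω : Type*} [MeasurableSpace Ω] (P : Measure Ω) {k n d : ℕ}
    (ε : Fin k → ℝ) (Pop : Fin k → Measure (Vec d))
    (Y : Fin n → Ω → Fin k) (X : Fin n → Ω → Vec d) : Prop where
  measurable_label : ∀ j, Measurable (Y j)
  measurable_obs : ∀ j, Measurable (X j)
  indep : iIndepFun (fun j ω => (Y j ω, X j ω)) P
  law : ∀ j i (A : Set (Vec d)), MeasurableSet A →
    P {ω | Y j ω = i ∧ X j ω ∈ A} = ENNReal.ofReal (ε i) * Pop i A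

/-- An eigen-decomposition of a matrix: orthonormal eigenvectors `v`, with the eigenvalues `lam`
in decreasing order. -/
structure IsEigenDecomp {p : ℕ} (A : Matrix (Fin p) (Fin p) ℝ) (lam : Fin p → ℝ)
    (v : Fin p → Vec p) : Prop where
  antitone : Antitone lam
  orthonormal : Orthonormal ℝ v
  eigen : ∀ i, A.mulVec (v i).ofLp = lam i • (v i).ofLp

section Sample

variable {n : ℕ}

/-- Sample mean. -/
noncomputable def sampleMean {d : ℕ} (x : Fin n → Vec d) : Vec d := (n : ℝ)⁻¹ • ∑ j, x j

/-- The `n × n` dual sample covariance matrix. -/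
noncomputable def dualCov {d : ℕ} (x : Fin n → Vec d) : Matrix (Fin n) (Fin n) ℝ :=
  Matrix.of fun j j' => ⟪x j - sampleMean x, x j' - sampleMean x⟫ / ((n : ℝ) - 1)

/-- `n_i`: the number of observations with label `i`. -/
def classCount {k : ℕ} (l : Fin n → Fin k) (i : Fin k) : ℕ :=
  (Finset.univ.filter fun j => l j = i).card

/-- `η_i = n_i / n`. -/
noncomputable def classFreq {k : ℕ} (l : Fin n → Fin k) (i : Fin k) : ℝ :=
  (classCount l i : ℝ) / n

/-- The sum of the frequencies of the first `r` classes. -/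
noncomputable def cumFreq {k : ℕ} (l : Fin n → Fin k) (r : ℕ) : ℝ :=
  ∑ a ∈ Finset.univ.filter (fun a : Fin k => (a : ℕ) < r), classFreq l a

/-- The limit of the `i`-th normalized sample score of an observation of class `c`. Indices start
at `0`, so `cumFreq l (i + 1)` and `cumFreq l i` are the sums of the frequencies up to and
including class `i`, and strictly before class `i`. -/
noncomputable def scoreLimit {m : ℕ} (l : Fin n → Fin (m + 1)) (i : Fin m) (c : Fin (m + 1)) : ℝ :=
  if c < i.castSucc then 0
  else if c = i.castSucc then
    √((1 - cumFreq l (i + 1)) / (classFreq l i.castSucc * (1 - cumFreq l i)))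
  else -√(classFreq l i.castSucc / ((1 - cumFreq l (i + 1)) * (1 - cumFreq l i)))

end Sample

section WeightedScores

variable {m : ℕ}

/-- The sum of the weights of the first `r` classes. -/
noncomputable def cumWeight (w : Fin (m + 1) → ℝ) (r : ℕ) : ℝ :=
  ∑ a ∈ Finset.univ.filter (fun a : Fin (m + 1) => (a : ℕ) < r), w a

/-- The Gram-Schmidt scores of the indicators of the initial segments of the classes, with respect
to the inner product with weights `w`. -/
noncomputable def weightedScore (w : Fin (m + 1) → ℝ) (i : Fin m) (c : Fin (m + 1)) : ℝ :=
  if c < i.castSucc then 0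
  else if c = i.castSucc then
    √((1 - cumWeight w (i + 1)) / (w i.castSucc * (1 - cumWeight w i)))
  else -√(w i.castSucc / ((1 - cumWeight w (i + 1)) * (1 - cumWeight w i)))

/-- The total weight of the classes after class `i`. -/
noncomputable def tailWeight (w : Fin (m + 1) → ℝ) (i : Fin m) : ℝ :=
  ∑ c ∈ Finset.univ.filter (fun c => i.castSucc < c), w c

lemma sum_eq_add_tail {G : Fin (m + 1) → ℝ} {i : Fin m} (h0 : ∀ c < i.castSucc, G c = 0) :
    ∑ c, G c = G i.castSucc + ∑ c ∈ Finset.univ.filter (fun c => i.castSucc < c), G c := by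
  classical
  have hsub : insert i.castSucc (Finset.univ.filter (fun c => i.castSucc < c)) ⊆
      (Finset.univ : Finset (Fin (m + 1))) := Finset.subset_univ _
  rw [← Finset.sum_subset hsub, Finset.sum_insert (by simp)]
  intro c _ hc
  apply h0
  simp only [Finset.mem_insert, Finset.mem_filter, Finset.mem_univ, true_and, not_or, not_lt] at hc
  exact lt_of_le_of_ne hc.2 hc.1

lemma tailWeight_pos {w : Fin (m + 1) → ℝ} (hw : ∀ c, 0 < w c) (i : Fin m) :
    0 < tailWeight w i :=
  Finset.sum_pos (fun c _ => hw c) ⟨i.succ, by simp⟩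

lemma one_sub_cumWeight_succ {w : Fin (m + 1) → ℝ} (hsum : ∑ c, w c = 1) (i : Fin m) :
    1 - cumWeight w (i + 1) = tailWeight w i := by
  rw [← hsum, ← Finset.sum_filter_add_sum_filter_not Finset.univ
    (fun a : Fin (m + 1) => (a : ℕ) < i + 1), cumWeight, tailWeight, add_sub_cancel_left]
  congr 1
  ext c
  simp [Fin.lt_def]

lemma one_sub_cumWeight {w : Fin (m + 1) → ℝ} (hsum : ∑ c, w c = 1) (i : Fin m) :
    1 - cumWeight w i = w i.castSucc + tailWeight w i := by
  have h : cumWeight w (i + 1) = w i.castSucc + cumWeight w i := by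
    classical
    rw [cumWeight, cumWeight, ← Finset.sum_insert (by simp)]
    congr 1
    ext c
    simp [Fin.ext_iff]
    omega
  have := one_sub_cumWeight_succ hsum i
  linarith

lemma eq_of_const_tail {φ : Fin (m + 1) → ℝ} {i : Fin m}
    (h : ∀ c : Fin m, i < c → φ c.castSucc = φ c.succ) :
    ∀ c, i.castSucc < c → φ c = φ i.succ := by
  intro c
  induction c using Fin.induction with
  | zero => intro hc; exact absurd hc (by simp)
  | succ c ih =>
    intro hc
    rcases lt_or_ge i c with hic | hic
    · rw [← h c hic, ih (by simpa using hic)]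
    · have : i = c := by
        apply le_antisymm _ hic
        have := Fin.lt_def.1 hc
        rw [Fin.val_castSucc, Fin.val_succ] at this
        exact Fin.le_def.2 (by omega)
      rw [this]

lemma weighted_sum_of_const_tail {w φ ψ : Fin (m + 1) → ℝ} {i : Fin m}
    (h : ∀ c : Fin m, i < c → φ c.castSucc = φ c.succ) (h0 : ∀ c < i.castSucc, φ c = 0) :
    ∑ c, w c * φ c * ψ c = w i.castSucc * φ i.castSucc * ψ i.castSucc +
      φ i.succ * ∑ c ∈ Finset.univ.filter (fun c => i.castSucc < c), w c * ψ c := by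
  rw [sum_eq_add_tail (i := i) (fun c hc => by rw [h0 c hc]; ring), Finset.mul_sum]
  congr 1
  refine Finset.sum_congr rfl fun c hc => ?_
  rw [eq_of_const_tail h c (by simpa using hc)]
  ring

/-- Orthonormal centred systems whose `i`-th member is constant beyond class `i` are triangular. -/
lemma vanish_of_orthonormal {w : Fin (m + 1) → ℝ} (hw : ∀ c, 0 < w c)
    {g : Fin m → Fin (m + 1) → ℝ}
    (horth : ∀ i i', ∑ c, w c * g i c * g i' c = if i = i' then 1 else 0)
    (hzero : ∀ i, ∑ c, w c * g i c = 0)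
    (hconst : ∀ i c : Fin m, i < c → g i c.castSucc = g i c.succ) :
    ∀ (N : ℕ) (c : Fin (m + 1)), (c : ℕ) = N → ∀ r : Fin m, c < r.castSucc → g r c = 0 := by
  intro N
  induction N using Nat.strong_induction_on with
  | _ N ih =>
    intro c hc r hcr
    obtain ⟨i, rfl⟩ : ∃ i : Fin m, i.castSucc = c :=
      ⟨⟨c, lt_trans (Fin.lt_def.1 hcr) r.2⟩, rfl⟩
    have hir : i < r := by simpa using hcr
    have v1 : ∀ c < i.castSucc, g i c = 0 := fun c' hc' =>
      ih c' (by rw [← hc]; exact hc') c' rfl i hc'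
    have v2 : ∀ c < i.castSucc, g r c = 0 := fun c' hc' =>
      ih c' (by rw [← hc]; exact hc') c' rfl r (hc'.trans hcr)
    have e1 := horth i r
    rw [if_neg hir.ne, weighted_sum_of_const_tail (hconst i) v1] at e1
    have e2 := hzero r
    rw [sum_eq_add_tail (i := i) (fun c hc => by rw [v2 c hc]; ring)] at e2
    have e3 := horth i i
    rw [if_pos rfl, weighted_sum_of_const_tail (hconst i) v1] at e3
    have e4 := hzero i
    rw [sum_eq_add_tail (i := i) (fun c hc => by rw [v1 c hc]; ring)] at e4
    have hne : g i i.castSucc ≠ g i i.succ := by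
      intro hEq
      rw [← hEq] at e3
      have : g i i.castSucc * (w i.castSucc * g i i.castSucc +
        ∑ c ∈ Finset.univ.filter (fun c => i.castSucc < c), w c * g i c) = 1 := by linarith
      rw [e4] at this
      simp at this
    have : (g i i.castSucc - g i i.succ) * (w i.castSucc * g r i.castSucc) = 0 := by
      linear_combination e1 - g i i.succ * e2
    rcases mul_eq_zero.1 this with h | h
    · exact absurd (sub_eq_zero.1 h) hne
    · exact (mul_eq_zero.1 h).resolve_left (hw _).ne'

lemma eq_or_eq_neg_weightedScore {w : Fin (m + 1) → ℝ} (hw : ∀ c, 0 < w c) (hsum : ∑ c, w c = 1)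
    {g : Fin m → Fin (m + 1) → ℝ}
    (horth : ∀ i i', ∑ c, w c * g i c * g i' c = if i = i' then 1 else 0)
    (hzero : ∀ i, ∑ c, w c * g i c = 0)
    (hconst : ∀ i c : Fin m, i < c → g i c.castSucc = g i c.succ) (i : Fin m) :
    (∀ c, g i c = weightedScore w i c) ∨ (∀ c, g i c = -weightedScore w i c) := by
  have v1 : ∀ c < i.castSucc, g i c = 0 := fun c hc =>
    vanish_of_orthonormal hw horth hzero hconst c c rfl i hc
  have e3 := horth i i
  rw [if_pos rfl, weighted_sum_of_const_tail (hconst i) v1] at e3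
  have e4 := hzero i
  rw [sum_eq_add_tail (i := i) (fun c hc => by rw [v1 c hc]; ring)] at e4
  have hT : ∑ c ∈ Finset.univ.filter (fun c => i.castSucc < c), w c * g i c
      = tailWeight w i * g i i.succ := by
    rw [tailWeight, Finset.sum_mul]
    refine Finset.sum_congr rfl fun c hc => ?_
    rw [eq_of_const_tail (hconst i) c (by simpa using hc)]
  rw [hT] at e3 e4
  have hTp := tailWeight_pos hw i
  have hwp := hw i.castSucc
  have ha : (g i i.castSucc) ^ 2 = tailWeight w i / (w i.castSucc * (w i.castSucc + tailWeight w i)) := by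
    rw [eq_div_iff (by positivity)]
    linear_combination tailWeight w i * e3 + (w i.castSucc * g i i.castSucc - tailWeight w i * g i i.succ) * e4
  have hb : (g i i.succ) ^ 2 = w i.castSucc / (tailWeight w i * (w i.castSucc + tailWeight w i)) := by
    rw [eq_div_iff (by positivity)]
    linear_combination w i.castSucc * e3 - (w i.castSucc * g i i.castSucc - tailWeight w i * g i i.succ) * e4
  have key : ∀ c, weightedScore w i c = if c < i.castSucc then 0 else if c = i.castSucc then
      |g i i.castSucc| else - |g i i.succ| := by
    intro c
    rw [weightedScore, one_sub_cumWeight_succ hsum, one_sub_cumWeight hsum, ← ha, ← hb,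
      Real.sqrt_sq_eq_abs, Real.sqrt_sq_eq_abs]
  rcases le_total 0 (g i i.castSucc) with h | h
  · left
    have h' : g i i.succ ≤ 0 := by
      by_contra hcon
      push Not at hcon
      have := mul_nonneg hwp.le h
      have := mul_pos hTp hcon
      linarith
    intro c
    rw [key, abs_of_nonneg h, abs_of_nonpos h', neg_neg]
    split_ifs with h1 h2
    · exact v1 c h1
    · rw [h2]
    · exact eq_of_const_tail (hconst i) c (lt_of_le_of_ne (not_lt.1 h1) (Ne.symm h2))
  · right
    have h' : 0 ≤ g i i.succ := by
      by_contra hcon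
      push Not at hcon
      have := mul_nonneg_of_nonpos_of_nonpos (neg_nonpos.2 hwp.le) h
      have := mul_neg_of_pos_of_neg hTp hcon
      linarith
    intro c
    rw [key, abs_of_nonpos h, abs_of_nonneg h']
    split_ifs with h1 h2
    · simpa using v1 c h1
    · rw [h2, neg_neg]
    · rw [neg_neg]
      exact eq_of_const_tail (hconst i) c (lt_of_le_of_ne (not_lt.1 h1) (Ne.symm h2))

lemma weightedScore_castSucc_pos {w : Fin (m + 1) → ℝ} (hw : ∀ c, 0 < w c) (hsum : ∑ c, w c = 1)
    (i : Fin m) : 0 < weightedScore w i i.castSucc := by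
  have hTp := tailWeight_pos hw i
  have hwp := hw i.castSucc
  rw [weightedScore, if_neg (lt_irrefl _), if_pos rfl, one_sub_cumWeight_succ hsum,
    one_sub_cumWeight hsum]
  positivity

lemma weightedScore_nonpos (w : Fin (m + 1) → ℝ) (i : Fin m) (c : Fin (m + 1))
    (hc : c ≠ i.castSucc) : weightedScore w i c ≤ 0 := by
  rw [weightedScore, if_neg hc]
  split_ifs
  · exact le_rfl
  · exact neg_nonpos.2 (Real.sqrt_nonneg _)

end WeightedScores

section Eigen

variable {p : ℕ} {A : Matrix (Fin p) (Fin p) ℝ} {lam : Fin p → ℝ} {v : Fin p → Vec p}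

lemma IsEigenDecomp.dotProduct_mulVec (h : IsEigenDecomp A lam v) (y : Vec p) (i : Fin p) :
    y.ofLp ⬝ᵥ A.mulVec (v i).ofLp = lam i * ⟪y, v i⟫ := by
  rw [h.eigen, dotProduct_smul, smul_eq_mul, EuclideanSpace.inner_eq_star_dotProduct]
  simp [dotProduct_comm]

/-- The part of Courant-Fischer that bounds a quadratic form on the orthogonal complement of the
leading eigenvectors. -/
lemma IsEigenDecomp.quadForm_le (h : IsEigenDecomp A lam v) (y : Vec p) (r : Fin p)
    (hy : ∀ q < r, ⟪v q, y⟫ = 0) : y.ofLp ⬝ᵥ A.mulVec y.ofLp ≤ lam r * ‖y‖ ^ 2 := by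
  have hcard : Fintype.card (Fin p) = Module.finrank ℝ (Vec p) := by simp
  let b : OrthonormalBasis (Fin p) ℝ (Vec p) :=
    OrthonormalBasis.mk h.orthonormal
      (h.orthonormal.linearIndependent.span_eq_top_of_card_eq_finrank' hcard).ge
  have hb : ∀ q, b q = v q := fun q => by simp [b]
  have hexp : y.ofLp = ∑ q, ⟪v q, y⟫ • (v q).ofLp := by
    have := b.sum_repr' y
    simp only [hb] at this
    conv_lhs => rw [← this]
    simp
  have hnorm : ∑ q, ⟪v q, y⟫ ^ 2 = ‖y‖ ^ 2 := by
    have := b.sum_sq_norm_inner_right y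
    simpa [hb] using this
  have h1 : y.ofLp ⬝ᵥ A.mulVec y.ofLp = ∑ q, lam q * ⟪v q, y⟫ ^ 2 := by
    conv_lhs => rw [show A.mulVec y.ofLp = A.mulVec (∑ q, ⟪v q, y⟫ • (v q).ofLp) by rw [← hexp]]
    rw [Matrix.mulVec_sum, dotProduct_sum]
    refine Finset.sum_congr rfl fun q _ => ?_
    rw [Matrix.mulVec_smul, dotProduct_smul, h.dotProduct_mulVec, real_inner_comm, smul_eq_mul]
    ring
  rw [h1, ← hnorm, Finset.mul_sum]
  refine Finset.sum_le_sum fun q _ => ?_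
  rcases lt_or_ge q r with hq | hq
  · rw [hy q hq]; simp
  · exact mul_le_mul_of_nonneg_right (h.antitone hq) (sq_nonneg _)

end Eigen

section Steps

variable {m : ℕ} {E : Type*} [NormedAddCommGroup E] [InnerProductSpace ℝ E]

/-- The combination of the normalized vectors `s i / ‖s i‖` with coefficients `c`. -/
noncomputable def unitComb (s : Fin m → E) (c : Fin m → ℝ) : E := ∑ i, (c i * ‖s i‖⁻¹) • s i

/-- Nonzero vectors of decreasing length that are nearly orthogonal. -/
structure NearlyOrthogonal (s : Fin m → E) : Prop where
  ne_zero : ∀ i, s i ≠ 0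
  antitone : ∀ i j, i ≤ j → ‖s j‖ ≤ ‖s i‖
  inner_le : ∀ i j, i ≠ j → |⟪s i, s j⟫| ≤ ‖s i‖ * ‖s j‖ / (2 * m)

variable {s : Fin m → E}

lemma NearlyOrthogonal.norm_pos (hs : NearlyOrthogonal s) (i : Fin m) : 0 < ‖s i‖ :=
  norm_pos_iff.2 (hs.ne_zero i)

lemma NearlyOrthogonal.norm_unitComb_le (hs : NearlyOrthogonal s) {c : Fin m → ℝ} {p : Fin m}
    (hp : ∀ i, |c i| ≤ |c p|) : ‖unitComb s c‖ ≤ m * |c p| := by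
  calc ‖unitComb s c‖ ≤ ∑ i, ‖(c i * ‖s i‖⁻¹) • s i‖ := norm_sum_le _ _
    _ ≤ ∑ _i : Fin m, |c p| := Finset.sum_le_sum fun i _ => by
      have := hs.norm_pos i
      rw [norm_smul, norm_mul, norm_inv, norm_norm, mul_assoc, inv_mul_cancel₀ this.ne', mul_one]
      exact hp i
    _ = m * |c p| := by simp

lemma NearlyOrthogonal.le_inner_unitComb (hs : NearlyOrthogonal s) {c : Fin m → ℝ} {p : Fin m}
    (hp : ∀ i, |c i| ≤ |c p|) : ‖s p‖ * |c p| / 2 ≤ |⟪unitComb s c, s p⟫| := by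
  have hm : 0 < (m : ℝ) := by exact_mod_cast p.pos
  have hpp := hs.norm_pos p
  have e : ⟪unitComb s c, s p⟫ = c p * ‖s p‖ +
      ∑ i ∈ Finset.univ.erase p, (c i * ‖s i‖⁻¹) * ⟪s i, s p⟫ := by
    rw [unitComb, sum_inner, ← Finset.add_sum_erase _ _ (Finset.mem_univ p)]
    congr 1
    · rw [real_inner_smul_left, real_inner_self_eq_norm_sq]
      field_simp
    · exact Finset.sum_congr rfl fun i _ => real_inner_smul_left _ _ _
  have hb : |∑ i ∈ Finset.univ.erase p, (c i * ‖s i‖⁻¹) * ⟪s i, s p⟫| ≤ ‖s p‖ * |c p| / 2 := by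
    calc _ ≤ ∑ i ∈ Finset.univ.erase p, |(c i * ‖s i‖⁻¹) * ⟪s i, s p⟫| :=
          Finset.abs_sum_le_sum_abs _ _
      _ ≤ ∑ i ∈ Finset.univ.erase p, |c p| * ‖s p‖ / (2 * m) := by
          refine Finset.sum_le_sum fun i hi => ?_
          have hi' := hs.norm_pos i
          rw [abs_mul, abs_mul, abs_inv, abs_norm]
          calc |c i| * ‖s i‖⁻¹ * |⟪s i, s p⟫|
              ≤ |c p| * ‖s i‖⁻¹ * (‖s i‖ * ‖s p‖ / (2 * m)) := by
                refine mul_le_mul (mul_le_mul_of_nonneg_right (hp i) (by positivity))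
                  (hs.inner_le i p (Finset.ne_of_mem_erase hi)) (abs_nonneg _) (by positivity)
            _ = |c p| * ‖s p‖ / (2 * m) := by field_simp
      _ ≤ ∑ _i : Fin m, |c p| * ‖s p‖ / (2 * m) :=
          Finset.sum_le_sum_of_subset_of_nonneg (Finset.subset_univ _) fun _ _ _ => by positivity
      _ = ‖s p‖ * |c p| / 2 := by
          simp only [Finset.sum_const, Finset.card_univ, Fintype.card_fin, nsmul_eq_mul]
          field_simp
  have h3 : |c p * ‖s p‖| = ‖s p‖ * |c p| := by rw [abs_mul, abs_norm, mul_comm]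
  rw [e]
  have := abs_sub_abs_le_abs_sub (c p * ‖s p‖)
    (-∑ i ∈ Finset.univ.erase p, (c i * ‖s i‖⁻¹) * ⟪s i, s p⟫)
  rw [abs_neg, sub_neg_eq_add] at this
  linarith

/-- A combination of the first vectors has a large inner product with one of them. -/
lemma NearlyOrthogonal.exists_inner_unitComb (hs : NearlyOrthogonal s) {c : Fin m → ℝ} {r : Fin m}
    (hc : c ≠ 0) (hcr : ∀ i, r < i → c i = 0) :
    ∃ p ≤ r, ⟪unitComb s c, s p⟫ ≠ 0 ∧
      ‖s r‖ ^ 2 * ‖unitComb s c‖ ^ 2 ≤ 4 * m ^ 2 * ⟪unitComb s c, s p⟫ ^ 2 := by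
  obtain ⟨p, -, hp⟩ := Finset.exists_max_image Finset.univ (fun i => |c i|) ⟨r, Finset.mem_univ r⟩
  replace hp : ∀ i, |c i| ≤ |c p| := fun i => hp i (Finset.mem_univ i)
  have hcp : 0 < |c p| := by
    rw [abs_pos]
    intro h0
    apply hc
    funext i
    have := hp i
    rw [h0, abs_zero] at this
    exact abs_eq_zero.1 (le_antisymm this (abs_nonneg _))
  have hpr : p ≤ r := by
    by_contra hcon
    rw [hcr p (not_le.1 hcon)] at hcp
    simp at hcp
  have h1 := hs.le_inner_unitComb hp
  have h2 := hs.norm_unitComb_le hp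
  have hpp := hs.norm_pos p
  refine ⟨p, hpr, ?_, ?_⟩
  · intro h0
    rw [h0, abs_zero] at h1
    have : 0 < ‖s p‖ * |c p| / 2 := by positivity
    linarith
  · have h3 : ‖s r‖ * ‖unitComb s c‖ ≤ 2 * m * |⟪unitComb s c, s p⟫| := by
      calc ‖s r‖ * ‖unitComb s c‖ ≤ ‖s p‖ * (m * |c p|) := by
            gcongr
            exact hs.antitone p r hpr
        _ = 2 * m * (‖s p‖ * |c p| / 2) := by ring
        _ ≤ _ := by gcongr
    have := pow_le_pow_left₀ (by positivity) h3 2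
    rw [mul_pow, mul_pow, sq_abs] at this
    nlinarith

/-- Coefficients of the first `r + 1` vectors can be chosen to satisfy `r` linear conditions. -/
lemma exists_coeff_of_linear {r : Fin m} (L : (Fin m → ℝ) →ₗ[ℝ] (Fin r → ℝ)) :
    ∃ c : Fin m → ℝ, c ≠ 0 ∧ (∀ i, r < i → c i = 0) ∧ L c = 0 := by
  classical
  let emb : (Fin (r + 1) → ℝ) →ₗ[ℝ] (Fin m → ℝ) :=
    LinearMap.pi fun i => if hi : (i : ℕ) < r + 1 then LinearMap.proj ⟨i, hi⟩ else 0
  have hdim : Module.finrank ℝ (Fin r → ℝ) < Module.finrank ℝ (Fin (r + 1) → ℝ) := by simp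
  obtain ⟨x, hx, hx0⟩ := (Submodule.ne_bot_iff _).1
    (LinearMap.ker_ne_bot_of_finrank_lt (f := L.comp emb) hdim)
  refine ⟨emb x, fun h0 => hx0 ?_, fun i hi => ?_, by simpa using hx⟩
  · ext q
    have := congrFun h0 ⟨q, by omega⟩
    simp only [emb, LinearMap.pi_apply, q.2, dite_true, LinearMap.proj_apply] at this
    exact this
  · have : ¬ (i : ℕ) < r + 1 := by
      have := Fin.lt_def.1 hi
      omega
    simp only [emb, LinearMap.pi_apply, this, dite_false, LinearMap.zero_apply]

/-- The vectors between `a` and `b` sum to a vector of length comparable to the first one. -/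
lemma NearlyOrthogonal.le_norm_sum (hs : NearlyOrthogonal s) (S : Finset (Fin m)) {a : Fin m}
    (ha : a ∈ S) (hS : ∀ i ∈ S, a ≤ i) : ‖s a‖ / 2 ≤ ‖∑ i ∈ S, s i‖ := by
  classical
  have e : ∑ i ∈ S, s i = unitComb s (fun i => if i ∈ S then ‖s i‖ else 0) := by
    rw [unitComb, ← Finset.sum_subset (Finset.subset_univ S)]
    · refine Finset.sum_congr rfl fun i hi => ?_
      rw [if_pos hi, mul_inv_cancel₀ (hs.norm_pos i).ne', one_smul]
    · intro i _ hi
      simp [hi]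
  have hp := hs.norm_pos a
  have h1 := hs.le_inner_unitComb (c := fun i => if i ∈ S then ‖s i‖ else 0) (p := a) (by
    intro i
    by_cases hi : i ∈ S
    · simpa [hi, ha] using hs.antitone a i (hS i hi)
    · simp [hi, ha])
  rw [← e] at h1
  have h2 := abs_real_inner_le_norm (∑ i ∈ S, s i) (s a)
  simp only [ha, if_true, abs_norm] at h1
  have : ‖s a‖ * (‖s a‖ / 2) ≤ ‖s a‖ * ‖∑ i ∈ S, s i‖ := by linarith
  exact le_of_mul_le_mul_left this hp

end Steps

section Moments

variable {d : ℕ} {ν : Measure (Vec d)}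

lemma inner_eq_sum_mul (y x : Vec d) : ⟪y, x⟫ = ∑ a, y a * x a := by
  simp [PiLp.inner_apply, mul_comm]

lemma MeasureTheory.MemLp.inner_left (hν : MemLp (fun x : Vec d => x) 2 ν) (y : Vec d) :
    MemLp (fun x => ⟪y, x⟫) 2 ν :=
  hν.const_inner y

lemma MeasureTheory.MemLp.coord (hν : MemLp (fun x : Vec d => x) 2 ν) (a : Fin d) :
    MemLp (fun x : Vec d => x a) 2 ν := by
  simpa [EuclideanSpace.inner_single_left] using hν.inner_left (EuclideanSpace.single a 1)

lemma dotProduct_covMat_mulVec [IsProbabilityMeasure ν] (hν : MemLp (fun x : Vec d => x) 2 ν)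
    (y y' : Vec d) : y.ofLp ⬝ᵥ (covMat ν).mulVec y'.ofLp =
      cov[fun x : Vec d => ⟪y, x⟫, fun x : Vec d => ⟪y', x⟫; ν] := by
  simp_rw [inner_eq_sum_mul]
  rw [covariance_fun_sum_fun_sum (fun a => (hν.coord a).const_mul _)
    (fun a => (hν.coord a).const_mul _)]
  simp_rw [covariance_const_mul_left, covariance_const_mul_right, dotProduct, Matrix.mulVec,
    dotProduct, Finset.mul_sum, covMat, Matrix.of_apply]
  refine Finset.sum_congr rfl fun a _ => Finset.sum_congr rfl fun b _ => ?_
  ring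

lemma integral_inner_eq [IsProbabilityMeasure ν] (hν : MemLp (fun x : Vec d => x) 2 ν)
    (y : Vec d) : ∫ x, ⟪y, x⟫ ∂ν = ⟪y, meanVec ν⟫ := by
  rw [meanVec, integral_inner (hν.integrable (by norm_num))]

lemma dotProduct_covMat_mulVec_eq_integral [IsProbabilityMeasure ν]
    (hν : MemLp (fun x : Vec d => x) 2 ν) (y y' : Vec d) :
    y.ofLp ⬝ᵥ (covMat ν).mulVec y'.ofLp =
      ∫ x, ⟪y, x - meanVec ν⟫ * ⟪y', x - meanVec ν⟫ ∂ν := by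
  rw [dotProduct_covMat_mulVec hν, covariance, integral_inner_eq hν, integral_inner_eq hν]
  simp_rw [inner_sub_right]

lemma integral_inner_mul_inner [IsProbabilityMeasure ν] (hν : MemLp (fun x : Vec d => x) 2 ν)
    (y y' μ : Vec d) : ∫ x, ⟪y, x - μ⟫ * ⟪y', x - μ⟫ ∂ν =
      y.ofLp ⬝ᵥ (covMat ν).mulVec y'.ofLp + ⟪y, meanVec ν - μ⟫ * ⟪y', meanVec ν - μ⟫ := by
  have h1 : ∀ z : Vec d, MemLp (fun x => ⟪z, x⟫ - ⟪z, μ⟫) 2 ν := fun z =>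
    (hν.inner_left z).sub (memLp_const _)
  have hi : ∀ z : Vec d, Integrable (fun x => ⟪z, x⟫) ν := fun z =>
    (hν.inner_left z).integrable (by norm_num)
  have h2 := covariance_eq_sub (h1 y) (h1 y')
  rw [covariance_sub_const_left (hi y), covariance_sub_const_right (hi y'),
    ← dotProduct_covMat_mulVec hν] at h2
  rw [integral_sub (hi y) (integrable_const _), integral_sub (hi y') (integrable_const _),
    integral_inner_eq hν, integral_inner_eq hν] at h2
  simp only [integral_const, probReal_univ, one_smul, Pi.mul_apply] at h2
  simp_rw [inner_sub_right]
  linarith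

lemma covMat_apply_eq_integral [IsProbabilityMeasure ν] (hν : MemLp (fun x : Vec d => x) 2 ν)
    (a b : Fin d) :
    covMat ν a b = ∫ x, (x - meanVec ν) a * (x - meanVec ν) b ∂ν := by
  have := dotProduct_covMat_mulVec_eq_integral hν (EuclideanSpace.single a 1)
    (EuclideanSpace.single b 1)
  simpa [EuclideanSpace.inner_single_left] using this

lemma covMat_comm (ν : Measure (Vec d)) (a b : Fin d) : covMat ν a b = covMat ν b a := by
  simp [covMat, covariance_comm]

lemma trace_covMat_mul (ν ν' : Measure (Vec d)) :
    (covMat ν * covMat ν').trace = ∑ a, ∑ b, covMat ν a b * covMat ν' a b := by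
  simp only [Matrix.trace, Matrix.diag_apply, Matrix.mul_apply]
  refine Finset.sum_congr rfl fun a _ => Finset.sum_congr rfl fun b _ => ?_
  rw [covMat_comm ν']

lemma trace_covMat_mul_self_nonneg (ν : Measure (Vec d)) :
    0 ≤ (covMat ν * covMat ν).trace := by
  rw [trace_covMat_mul]
  exact Finset.sum_nonneg fun a _ => Finset.sum_nonneg fun b _ => mul_self_nonneg _

lemma trace_covMat_mul_le (ν ν' : Measure (Vec d)) :
    (covMat ν * covMat ν').trace ≤
      ((covMat ν * covMat ν).trace + (covMat ν' * covMat ν').trace) / 2 := by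
  simp_rw [trace_covMat_mul, ← Finset.sum_add_distrib, Finset.sum_div]
  refine Finset.sum_le_sum fun a _ => Finset.sum_le_sum fun b _ => ?_
  nlinarith [sq_nonneg (covMat ν a b - covMat ν' a b)]

lemma sq_dotProduct_covMat_mulVec_le (ν : Measure (Vec d)) (y y' : Vec d) :
    (y.ofLp ⬝ᵥ (covMat ν).mulVec y'.ofLp) ^ 2 ≤
      ‖y‖ ^ 2 * ‖y'‖ ^ 2 * (covMat ν * covMat ν).trace := by
  have e1 : y.ofLp ⬝ᵥ (covMat ν).mulVec y'.ofLp =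
      ∑ p : Fin d × Fin d, (y p.1 * y' p.2) * covMat ν p.1 p.2 := by
    rw [Fintype.sum_prod_type]
    simp_rw [dotProduct, Matrix.mulVec, dotProduct, Finset.mul_sum]
    refine Finset.sum_congr rfl fun a _ => Finset.sum_congr rfl fun b _ => ?_
    ring
  have e2 : ‖y‖ ^ 2 * ‖y'‖ ^ 2 = ∑ p : Fin d × Fin d, (y p.1 * y' p.2) ^ 2 := by
    rw [EuclideanSpace.real_norm_sq_eq, EuclideanSpace.real_norm_sq_eq, Fintype.sum_prod_type,
      Finset.sum_mul_sum]
    simp_rw [mul_pow]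
  have e3 : (covMat ν * covMat ν).trace = ∑ p : Fin d × Fin d, covMat ν p.1 p.2 ^ 2 := by
    rw [Fintype.sum_prod_type, trace_covMat_mul]
    simp_rw [sq]
  rw [e1, e2, e3]
  exact Finset.sum_mul_sq_le_sq_mul_sq _ _ _

lemma MeasureTheory.MemLp.coord_sub [IsProbabilityMeasure ν]
    (hν : MemLp (fun x : Vec d => x) 2 ν) (μ : Vec d) (a : Fin d) :
    MemLp (fun x : Vec d => (x - μ) a) 2 ν := by
  exact (hν.coord a).sub (memLp_const (μ a))

lemma trace_covMat [IsProbabilityMeasure ν] (hν : MemLp (fun x : Vec d => x) 2 ν) :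
    (covMat ν).trace = ∫ x, ‖x - meanVec ν‖ ^ 2 ∂ν := by
  simp_rw [Matrix.trace, Matrix.diag_apply, covMat_apply_eq_integral hν,
    EuclideanSpace.real_norm_sq_eq]
  rw [integral_finsetSum]
  · simp_rw [sq]
  · exact fun a _ => (hν.coord_sub _ a).integrable_sq

lemma trace_covMat_nonneg [IsProbabilityMeasure ν] (hν : MemLp (fun x : Vec d => x) 2 ν) :
    0 ≤ (covMat ν).trace := by
  rw [trace_covMat hν]
  exact integral_nonneg fun x => by positivity

lemma dotProduct_covMat_mulVec_self_nonneg [IsProbabilityMeasure ν]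
    (hν : MemLp (fun x : Vec d => x) 2 ν) (y : Vec d) :
    0 ≤ y.ofLp ⬝ᵥ (covMat ν).mulVec y.ofLp := by
  rw [dotProduct_covMat_mulVec_eq_integral hν]
  exact integral_nonneg fun x => mul_self_nonneg _

end Moments

section Mixture

variable {d k : ℕ} {ε : Fin k → ℝ} {Pop : Fin k → Measure (Vec d)}

lemma integral_mixture (hε : ∀ i, 0 ≤ ε i) {F : Type*} [NormedAddCommGroup F] [NormedSpace ℝ F]
    {g : Vec d → F} (hg : ∀ i, Integrable g (Pop i)) :
    ∫ x, g x ∂(mixture ε Pop) = ∑ i, ε i • ∫ x, g x ∂(Pop i) := by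
  rw [mixture, integral_finsetSum_measure
    (fun i _ => (hg i).smul_measure ENNReal.ofReal_ne_top)]
  refine Finset.sum_congr rfl fun i _ => ?_
  rw [integral_smul_measure, ENNReal.toReal_ofReal (hε i)]

lemma isProbabilityMeasure_mixture [∀ i, IsProbabilityMeasure (Pop i)] (hε : ∀ i, 0 ≤ ε i)
    (hsum : ∑ i, ε i = 1) : IsProbabilityMeasure (mixture ε Pop) := by
  constructor
  simp only [mixture, Measure.coe_finsetSum, Finset.sum_apply, Measure.smul_apply, measure_univ,
    smul_eq_mul, mul_one]
  rw [← ENNReal.ofReal_sum_of_nonneg fun i _ => hε i, hsum, ENNReal.ofReal_one]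

lemma memLp_mixture (hmom : ∀ i, MemLp (fun x : Vec d => x) 2 (Pop i)) :
    MemLp (fun x : Vec d => x) 2 (mixture ε Pop) := by
  have hm : AEStronglyMeasurable (fun x : Vec d => x) (mixture ε Pop) :=
    measurable_id.aestronglyMeasurable
  rw [memLp_two_iff_integrable_sq_norm hm, mixture, integrable_finsetSum_measure]
  exact fun i _ => (hmom i).norm.integrable_sq.smul_measure ENNReal.ofReal_ne_top

lemma meanVec_mixture [∀ i, IsProbabilityMeasure (Pop i)] (hε : ∀ i, 0 ≤ ε i)
    (hmom : ∀ i, MemLp (fun x : Vec d => x) 2 (Pop i)) :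
    meanVec (mixture ε Pop) = ∑ i, ε i • meanVec (Pop i) :=
  integral_mixture hε fun i => (hmom i).integrable (by norm_num)

/-- The covariance matrix of a mixture is the sum of the within and between covariances. -/
lemma dotProduct_covMat_mixture [∀ i, IsProbabilityMeasure (Pop i)] (hε : ∀ i, 0 ≤ ε i)
    (hsum : ∑ i, ε i = 1) (hmom : ∀ i, MemLp (fun x : Vec d => x) 2 (Pop i)) (y y' : Vec d) :
    y.ofLp ⬝ᵥ (covMat (mixture ε Pop)).mulVec y'.ofLp =
      ∑ i, ε i * (y.ofLp ⬝ᵥ (covMat (Pop i)).mulVec y'.ofLp) +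
      ∑ i, ε i * ⟪y, meanVec (Pop i) - meanVec (mixture ε Pop)⟫ *
        ⟪y', meanVec (Pop i) - meanVec (mixture ε Pop)⟫ := by
  have := isProbabilityMeasure_mixture (Pop := Pop) hε hsum
  have hint : ∀ i, Integrable (fun x => ⟪y, x - meanVec (mixture ε Pop)⟫ *
      ⟪y', x - meanVec (mixture ε Pop)⟫) (Pop i) := fun i => by
    have h1 : ∀ z : Vec d, MemLp (fun x => ⟪z, x - meanVec (mixture ε Pop)⟫) 2 (Pop i) := fun z =>
      ((hmom i).sub (memLp_const _)).const_inner z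
    exact (h1 y).integrable_mul (h1 y')
  rw [dotProduct_covMat_mulVec_eq_integral (memLp_mixture hmom), integral_mixture hε hint,
    ← Finset.sum_add_distrib]
  refine Finset.sum_congr rfl fun i _ => ?_
  rw [integral_inner_mul_inner (hmom i), smul_eq_mul]
  ring

lemma sum_inner_meanVec_sub [∀ i, IsProbabilityMeasure (Pop i)] (hε : ∀ i, 0 ≤ ε i)
    (hsum : ∑ i, ε i = 1) (hmom : ∀ i, MemLp (fun x : Vec d => x) 2 (Pop i)) (y : Vec d) :
    ∑ i, ε i * ⟪y, meanVec (Pop i) - meanVec (mixture ε Pop)⟫ = 0 := by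
  have : ∑ i, ε i • (meanVec (Pop i) - meanVec (mixture ε Pop)) = 0 := by
    simp_rw [smul_sub, Finset.sum_sub_distrib]
    rw [← Finset.sum_smul, hsum, one_smul, ← meanVec_mixture hε hmom, sub_self]
  have h2 := congrArg (fun z => ⟪y, z⟫) this
  simpa [inner_sum, real_inner_smul_right] using h2

end Mixture

section ConvergenceInProbability

variable {Ω : ℕ → Type*} [∀ d, MeasurableSpace (Ω d)]

/-- The filter of events whose probability tends to one: convergence in probability is convergence
along this filter. -/
def probFilter (Q : (d : ℕ) → Measure (Ω d)) : Filter (Σ d, Ω d) where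
  sets := {S | Tendsto (fun d => Q d {ω | (⟨d, ω⟩ : Σ d, Ω d) ∉ S}) atTop (𝓝 0)}
  univ_sets := by simp
  sets_of_superset := fun {S T} hS hST =>
    tendsto_of_tendsto_of_tendsto_of_le_of_le tendsto_const_nhds hS (fun _ => zero_le)
      fun d => measure_mono fun ω hω hS' => hω (hST hS')
  inter_sets := fun {S T} hS hT => by
    have h := hS.add hT
    rw [add_zero] at h
    refine tendsto_of_tendsto_of_tendsto_of_le_of_le tendsto_const_nhds h (fun _ => zero_le)
      fun d => ?_
    refine (measure_mono ?_).trans (measure_union_le _ _)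
    intro ω hω
    by_cases h1 : (⟨d, ω⟩ : Σ d, Ω d) ∈ S
    · exact Or.inr fun h2 => hω ⟨h1, h2⟩
    · exact Or.inl h1

variable {Q : (d : ℕ) → Measure (Ω d)}

lemma mem_probFilter {S : Set (Σ d, Ω d)} : S ∈ probFilter Q ↔
    Tendsto (fun d => Q d {ω | (⟨d, ω⟩ : Σ d, Ω d) ∉ S}) atTop (𝓝 0) := Iff.rfl

lemma tendsto_fst_probFilter : Tendsto Sigma.fst (probFilter Q) atTop := by
  intro S hS
  rw [mem_map, mem_probFilter]
  refine tendsto_const_nhds.congr' ?_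
  filter_upwards [hS] with d hd
  simp [hd]

lemma tendsto_probFilter_iff {f : (Σ d, Ω d) → ℝ} {c : ℝ} :
    Tendsto f (probFilter Q) (𝓝 c) ↔
      ∀ τ : ℝ, 0 < τ → Tendsto (fun d => Q d {ω | τ ≤ |f ⟨d, ω⟩ - c|}) atTop (𝓝 0) := by
  rw [Metric.tendsto_nhds]
  refine forall₂_congr fun τ _ => ?_
  rw [Filter.Eventually, mem_probFilter]
  simp [Real.dist_eq]

/-- Chebyshev's inequality for families of random variables. -/
lemma tendsto_probFilter_of_sq [∀ d, IsProbabilityMeasure (Q d)] {f : (d : ℕ) → Ω d → ℝ}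
    {b V : ℕ → ℝ} (hf : ∀ᶠ d in atTop, Integrable (fun ω => f d ω ^ 2) (Q d))
    (hV : ∀ᶠ d in atTop, ∫ ω, f d ω ^ 2 ∂(Q d) ≤ V d)
    (hlim : Tendsto (fun d => V d / b d ^ 2) atTop (𝓝 0)) :
    Tendsto (fun x : Σ d, Ω d => f x.1 x.2 / b x.1) (probFilter Q) (𝓝 0) := by
  rw [tendsto_probFilter_iff]
  intro τ hτ
  have h1 : Tendsto (fun d => ENNReal.ofReal (V d / b d ^ 2 / τ ^ 2)) atTop (𝓝 0) := by
    have := ENNReal.tendsto_ofReal (hlim.div_const (τ ^ 2))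
    simpa using this
  refine tendsto_of_tendsto_of_tendsto_of_le_of_le' tendsto_const_nhds h1
    (Eventually.of_forall fun _ => zero_le) ?_
  filter_upwards [hf, hV] with d hfd hVd
  have h2 := mul_meas_ge_le_integral_of_nonneg (μ := Q d) (f := fun ω => (f d ω / b d) ^ 2)
    (Eventually.of_forall fun _ => sq_nonneg _)
    (by simpa only [div_pow] using hfd.div_const _) (τ ^ 2)
  have h3 : ∫ ω, (f d ω / b d) ^ 2 ∂(Q d) ≤ V d / b d ^ 2 := by
    simp_rw [div_pow]
    rw [integral_div]
    gcongr
  have h4 : {ω | τ ≤ |f d ω / b d - 0|} ⊆ {ω | τ ^ 2 ≤ (f d ω / b d) ^ 2} := by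
    intro ω hω
    simp only [sub_zero, Set.mem_ofPred_eq] at hω ⊢
    rw [← sq_abs (f d ω / b d)]
    gcongr
  refine (measure_mono h4).trans ?_
  rw [← ENNReal.ofReal_toReal (measure_ne_top (Q d) _)]
  apply ENNReal.ofReal_le_ofReal
  rw [le_div_iff₀ (by positivity), mul_comm]
  exact h2.trans h3

end ConvergenceInProbability

section ConditionalSample

variable {Ω : Type*} [MeasurableSpace Ω] {P : Measure Ω} {k n d : ℕ}
  {ε : Fin k → ℝ} {Pop : Fin k → Measure (Vec d)} {Y : Fin n → Ω → Fin k} {X : Fin n → Ω → Vec d}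

lemma IsMixtureSample.map_cond (hX : IsMixtureSample P ε Pop Y X) (hε : ∀ i, 0 < ε i)
    [∀ i, IsProbabilityMeasure (Pop i)] (l : Fin n → Fin k) :
    (P[|{ω | ∀ j, Y j ω = l j}]).map (fun ω j => X j ω) = Measure.pi fun j => Pop (l j) := by
  have hprod : ∀ A : Fin n → Set (Vec d), (∀ j, MeasurableSet (A j)) →
      P ({ω | ∀ j, Y j ω = l j} ∩ {ω | ∀ j, X j ω ∈ A j}) =
        ∏ j, (ENNReal.ofReal (ε (l j)) * Pop (l j) (A j)) := by
    intro A hA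
    have h1 := hX.indep.measure_inter_preimage_eq_mul Finset.univ
      (sets := fun j => {l j} ×ˢ A j)
      fun j _ => (MeasurableSet.singleton _).prod (hA j)
    have h2 : {ω | ∀ j, Y j ω = l j} ∩ {ω | ∀ j, X j ω ∈ A j} =
        ⋂ j ∈ (Finset.univ : Finset (Fin n)),
          (fun ω => (Y j ω, X j ω)) ⁻¹' ({l j} ×ˢ A j) := by
      ext ω
      simp [forall_and]
    rw [h2, h1]
    refine Finset.prod_congr rfl fun j _ => ?_
    rw [← hX.law j (l j) (A j) (hA j)]
    rfl
  have hYm : MeasurableSet {ω | ∀ j, Y j ω = l j} := by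
    rw [Set.ofPred_forall]
    exact MeasurableSet.iInter fun j => hX.measurable_label j (MeasurableSet.singleton (l j))
  have hY : P {ω | ∀ j, Y j ω = l j} = ∏ j, ENNReal.ofReal (ε (l j)) := by
    have := hprod (fun _ => Set.univ) fun _ => MeasurableSet.univ
    simpa using this
  have hXm : Measurable fun ω j => X j ω := measurable_pi_lambda _ hX.measurable_obs
  symm
  refine Measure.pi_eq fun A hA => ?_
  rw [Measure.map_apply hXm (MeasurableSet.univ_pi hA), cond_apply hYm]
  have : (fun ω j => X j ω) ⁻¹' Set.univ.pi A = {ω | ∀ j, X j ω ∈ A j} := by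
    ext ω
    simp
  rw [this, hprod A hA, hY, Finset.prod_mul_distrib, ← mul_assoc, ENNReal.inv_mul_cancel, one_mul]
  · exact Finset.prod_ne_zero_iff.2 fun j _ => by simpa using hε _
  · exact ENNReal.prod_ne_top fun j _ => ENNReal.ofReal_ne_top

lemma IsMixtureSample.isProbabilityMeasure_cond (hX : IsMixtureSample P ε Pop Y X)
    (hε : ∀ i, 0 < ε i) [∀ i, IsProbabilityMeasure (Pop i)] (l : Fin n → Fin k) :
    IsProbabilityMeasure (P[|{ω | ∀ j, Y j ω = l j}]) := by
  constructor
  have h := congrArg (fun μ => μ Set.univ) (hX.map_cond hε l)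
  simpa [Measure.map_apply (measurable_pi_lambda _ hX.measurable_obs) MeasurableSet.univ] using h

lemma IsMixtureSample.map_cond_apply (hX : IsMixtureSample P ε Pop Y X) (hε : ∀ i, 0 < ε i)
    [∀ i, IsProbabilityMeasure (Pop i)] (l : Fin n → Fin k) (j : Fin n) :
    (P[|{ω | ∀ j, Y j ω = l j}]).map (X j) = Pop (l j) := by
  rw [← (measurePreserving_eval (fun j => Pop (l j)) j).map_eq, ← hX.map_cond hε l,
    Measure.map_map (measurable_pi_apply j) (measurable_pi_lambda _ hX.measurable_obs)]
  rfl

lemma IsMixtureSample.iIndepFun_cond (hX : IsMixtureSample P ε Pop Y X) (hε : ∀ i, 0 < ε i)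
    [∀ i, IsProbabilityMeasure (Pop i)] (l : Fin n → Fin k) :
    iIndepFun X (P[|{ω | ∀ j, Y j ω = l j}]) := by
  have := hX.isProbabilityMeasure_cond hε l
  rw [iIndepFun_iff_map_fun_eq_pi_map fun j => (hX.measurable_obs j).aemeasurable,
    hX.map_cond hε l]
  simp_rw [hX.map_cond_apply hε l]

end ConditionalSample

section ObservationMoments

variable {Ω : Type*} [MeasurableSpace Ω] {Q : Measure Ω} {d : ℕ} {X X' : Ω → Vec d}
  {ν ν' : Measure (Vec d)} [IsProbabilityMeasure ν] [IsProbabilityMeasure ν']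

lemma integrable_sq_inner_obs (hX : Measurable X) (hmap : Q.map X = ν)
    (hν : MemLp (fun x : Vec d => x) 2 ν) (y : Vec d) :
    Integrable (fun ω => ⟪y, X ω - meanVec ν⟫ ^ 2) Q := by
  have h1 : MemLp (fun x : Vec d => ⟪y, x - meanVec ν⟫) 2 ν :=
    (hν.sub (memLp_const _)).const_inner y
  have h2 := h1.integrable_sq
  rw [← hmap] at h2
  have := h2.comp_measurable hX
  rw [hmap] at this
  exact this

lemma integral_sq_inner_obs (hX : Measurable X) (hmap : Q.map X = ν)
    (hν : MemLp (fun x : Vec d => x) 2 ν) (y : Vec d) :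
    ∫ ω, ⟪y, X ω - meanVec ν⟫ ^ 2 ∂Q = y.ofLp ⬝ᵥ (covMat ν).mulVec y.ofLp := by
  rw [dotProduct_covMat_mulVec_eq_integral hν]
  have h : Measurable fun x : Vec d => ⟪y, x - meanVec ν⟫ * ⟪y, x - meanVec ν⟫ := by fun_prop
  have := integral_map hX.aemeasurable (μ := Q) h.aestronglyMeasurable
  rw [hmap] at this
  rw [this]
  simp_rw [sq]

lemma integrable_sq_norm_sq_obs (hX : Measurable X) (hmap : Q.map X = ν)
    (hν : MemLp (fun x => ‖x - meanVec ν‖ ^ 2) 2 ν) (t : ℝ) :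
    Integrable (fun ω => (‖X ω - meanVec ν‖ ^ 2 - t) ^ 2) Q := by
  have h2 := (hν.sub (memLp_const t)).integrable_sq
  rw [← hmap] at h2
  have := h2.comp_measurable hX
  rw [hmap] at this
  exact this

lemma integral_sq_norm_sq_obs (hX : Measurable X) (hmap : Q.map X = ν)
    (hν : MemLp (fun x : Vec d => x) 2 ν) :
    ∫ ω, (‖X ω - meanVec ν‖ ^ 2 - (covMat ν).trace) ^ 2 ∂Q =
      Var[fun x => ‖x - meanVec ν‖ ^ 2; ν] := by
  have hm : Measurable fun x : Vec d => ‖x - meanVec ν‖ ^ 2 := by fun_prop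
  rw [variance_eq_integral hm.aemeasurable, trace_covMat hν]
  have h : Measurable fun x : Vec d => (‖x - meanVec ν‖ ^ 2 - ∫ x, ‖x - meanVec ν‖ ^ 2 ∂ν) ^ 2 := by
    fun_prop
  have := integral_map hX.aemeasurable (μ := Q) h.aestronglyMeasurable
  rw [hmap] at this
  rw [this]

lemma integral_sq_inner_obs_obs (hX : Measurable X) (hX' : Measurable X')
    (hmap : Q.map X = ν) (hmap' : Q.map X' = ν') (hν : MemLp (fun x : Vec d => x) 2 ν)
    (hν' : MemLp (fun x : Vec d => x) 2 ν') (hind : IndepFun X X' Q) :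
    Integrable (fun ω => ⟪X ω - meanVec ν, X' ω - meanVec ν'⟫ ^ 2) Q ∧
    ∫ ω, ⟪X ω - meanVec ν, X' ω - meanVec ν'⟫ ^ 2 ∂Q = (covMat ν * covMat ν').trace := by
  have hφ : ∀ (μ : Vec d) (a b : Fin d), Measurable fun x : Vec d => (x - μ) a * (x - μ) b := by
    intro μ a b
    have : ∀ a, Measurable fun x : Vec d => (x - μ) a := fun a => by
      simp only [PiLp.sub_apply]
      fun_prop
    exact (this a).mul (this b)
  have hint : ∀ {X : Ω → Vec d} {ν : Measure (Vec d)} [IsProbabilityMeasure ν],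
      Measurable X → Q.map X = ν → MemLp (fun x : Vec d => x) 2 ν → ∀ a b,
      Integrable (fun ω => (X ω - meanVec ν) a * (X ω - meanVec ν) b) Q ∧
      ∫ ω, (X ω - meanVec ν) a * (X ω - meanVec ν) b ∂Q = covMat ν a b := by
    intro X ν _ hX hmap hν a b
    have h1 := (hν.coord_sub (meanVec ν) a).integrable_mul (hν.coord_sub (meanVec ν) b)
    constructor
    · rw [← hmap] at h1
      have := h1.comp_measurable hX
      rw [hmap] at this
      exact this
    · rw [covMat_apply_eq_integral hν]
      have := integral_map hX.aemeasurable (μ := Q) (hφ (meanVec ν) a b).aestronglyMeasurable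
      rw [hmap] at this
      rw [this]
  have hindab : ∀ a b, IndepFun (fun ω => (X ω - meanVec ν) a * (X ω - meanVec ν) b)
      (fun ω => (X' ω - meanVec ν') a * (X' ω - meanVec ν') b) Q := fun a b =>
    hind.comp (hφ (meanVec ν) a b) (hφ (meanVec ν') a b)
  have hi : ∀ a b, Integrable (fun ω => ((X ω - meanVec ν) a * (X ω - meanVec ν) b) *
      ((X' ω - meanVec ν') a * (X' ω - meanVec ν') b)) Q := fun a b =>
    (hindab a b).integrable_mul (hint hX hmap hν a b).1 (hint hX' hmap' hν' a b).1
  have e : ∀ ω, ⟪X ω - meanVec ν, X' ω - meanVec ν'⟫ ^ 2 =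
      ∑ a, ∑ b, ((X ω - meanVec ν) a * (X ω - meanVec ν) b) *
      ((X' ω - meanVec ν') a * (X' ω - meanVec ν') b) := by
    intro ω
    rw [inner_eq_sum_mul, sq, Finset.sum_mul_sum]
    refine Finset.sum_congr rfl fun a _ => Finset.sum_congr rfl fun b _ => ?_
    ring
  simp_rw [e]
  refine ⟨integrable_finsetSum _ fun a _ => integrable_finsetSum _ fun b _ => hi a b, ?_⟩
  rw [integral_finsetSum _ fun a _ => integrable_finsetSum _ fun b _ => hi a b, trace_covMat_mul]
  refine Finset.sum_congr rfl fun a _ => ?_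
  rw [integral_finsetSum _ fun b _ => hi a b]
  refine Finset.sum_congr rfl fun b _ => ?_
  rw [(hindab a b).integral_fun_mul_eq_mul_integral (hint hX hmap hν a b).1.aestronglyMeasurable
    (hint hX' hmap' hν' a b).1.aestronglyMeasurable, (hint hX hmap hν a b).2,
    (hint hX' hmap' hν' a b).2]

end ObservationMoments

section Telescope

variable {m : ℕ} {E : Type*}

lemma sub_eq_sum_steps [AddCommGroup E] (φ : Fin (m + 1) → E) (a : Fin (m + 1)) :
    ∀ b, a ≤ b → φ a - φ b =
      ∑ i ∈ Finset.univ.filter (fun i : Fin m => a ≤ i.castSucc ∧ i.castSucc < b),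
        (φ i.castSucc - φ i.succ) := by
  classical
  intro b
  induction b using Fin.induction with
  | zero =>
    intro ha
    have : a = 0 := le_antisymm ha (Fin.zero_le _)
    subst this
    simp
  | succ b ih =>
    intro ha
    rcases ha.eq_or_lt with rfl | hlt
    · rw [sub_self, Finset.filter_false_of_mem, Finset.sum_empty]
      rintro i - ⟨h1, h2⟩
      exact absurd (h1.trans_lt h2) (lt_irrefl _)
    · have hle : a ≤ b.castSucc := by
        rw [Fin.le_def]
        have := Fin.lt_def.1 hlt
        simp only [Fin.val_succ, Fin.val_castSucc] at this ⊢
        omega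
      have hset : Finset.univ.filter (fun i : Fin m => a ≤ i.castSucc ∧ i.castSucc < b.succ) =
          insert b (Finset.univ.filter
            (fun i : Fin m => a ≤ i.castSucc ∧ i.castSucc < b.castSucc)) := by
        ext i
        simp only [Finset.mem_filter, Finset.mem_univ, true_and, Finset.mem_insert, Fin.le_def,
          Fin.lt_def, Fin.val_succ, Fin.val_castSucc, Fin.ext_iff] at hle ⊢
        omega
      rw [hset, Finset.sum_insert (by simp), ← ih hle]
      abel

lemma half_sq_sub_le_sum {w g : Fin (m + 1) → ℝ} {e : ℝ} (he : 0 ≤ e) (hw : ∀ a, e ≤ w a)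
    (p : Fin m) : e / 2 * (g p.castSucc - g p.succ) ^ 2 ≤ ∑ a, w a * g a ^ 2 := by
  classical
  have hne : p.castSucc ≠ p.succ := Fin.castSucc_lt_succ.ne
  have h1 : ∑ a ∈ {p.castSucc, p.succ}, w a * g a ^ 2 ≤ ∑ a, w a * g a ^ 2 :=
    Finset.sum_le_sum_of_subset_of_nonneg (Finset.subset_univ _) fun a _ _ =>
      mul_nonneg (he.trans (hw a)) (sq_nonneg _)
  rw [Finset.sum_pair hne] at h1
  have h2 := mul_le_mul_of_nonneg_right (hw p.castSucc) (sq_nonneg (g p.castSucc))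
  have h3 := mul_le_mul_of_nonneg_right (hw p.succ) (sq_nonneg (g p.succ))
  nlinarith [mul_nonneg he (sq_nonneg (g p.castSucc + g p.succ))]

variable [NormedAddCommGroup E] [InnerProductSpace ℝ E]

lemma unitComb_add (s : Fin m → E) (c c' : Fin m → ℝ) :
    unitComb s (c + c') = unitComb s c + unitComb s c' := by
  simp [unitComb, add_mul, add_smul, Finset.sum_add_distrib]

lemma unitComb_smul (s : Fin m → E) (a : ℝ) (c : Fin m → ℝ) :
    unitComb s (a • c) = a • unitComb s c := by
  simp [unitComb, mul_assoc, mul_smul, Finset.smul_sum]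

/-- Coefficients of the first `r + 1` vectors whose combination is orthogonal to `r` vectors. -/
lemma exists_unitComb_orthogonal (s : Fin m → E) (r : Fin m) (z : Fin r → E) :
    ∃ c : Fin m → ℝ, c ≠ 0 ∧ (∀ i, r < i → c i = 0) ∧ ∀ q, ⟪z q, unitComb s c⟫ = 0 := by
  obtain ⟨c, h1, h2, h3⟩ := exists_coeff_of_linear (r := r)
    { toFun := fun c q => ⟪z q, unitComb s c⟫
      map_add' := fun c c' => by ext q; simp [unitComb_add, inner_add_right]
      map_smul' := fun a c => by ext q; simp [unitComb_smul, real_inner_smul_right] }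
  exact ⟨c, h1, h2, fun q => congrFun h3 q⟩

end Telescope

section Gaps

variable {d m : ℕ} {Pop : Fin (m + 1) → Measure (Vec d)}

lemma minGap_le_meanGap {i j : Fin (m + 1)} (hij : i < j) : minGap Pop ≤ meanGap Pop i j :=
  ciInf_le (Set.finite_range fun p : {p : Fin (m + 1) × Fin (m + 1) // p.1 < p.2} =>
    meanGap Pop p.1.1 p.1.2).bddBelow ⟨(i, j), hij⟩

lemma minGap_le_norm_stepVec (i : Fin m) : minGap Pop ≤ ‖stepVec Pop i‖ ^ 2 :=
  minGap_le_meanGap Fin.castSucc_lt_succ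

lemma norm_stepVec_le_minGap (hs : NearlyOrthogonal (stepVec Pop)) (i : Fin m)
    (hi : (i : ℕ) + 1 = m) : ‖stepVec Pop i‖ ^ 2 ≤ 4 * minGap Pop := by
  have : Nonempty {p : Fin (m + 1) × Fin (m + 1) // p.1 < p.2} :=
    ⟨⟨(i.castSucc, i.succ), Fin.castSucc_lt_succ⟩⟩
  suffices h : ‖stepVec Pop i‖ ^ 2 / 4 ≤ minGap Pop by linarith
  refine le_ciInf ?_
  rintro ⟨⟨a, b⟩, hab : a < b⟩
  obtain ⟨a', rfl⟩ : ∃ a' : Fin m, a'.castSucc = a :=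
    ⟨⟨a, by have := Fin.lt_def.1 hab; omega⟩, rfl⟩
  have h1 := hs.le_norm_sum
    (Finset.univ.filter (fun i : Fin m => a'.castSucc ≤ i.castSucc ∧ i.castSucc < b)) (a := a')
    (by simp [hab]) (by intro i hi; simpa using (Finset.mem_filter.1 hi).2.1)
  have h2 := sub_eq_sum_steps (fun c => meanVec (Pop c)) a'.castSucc b hab.le
  have h3 : ‖stepVec Pop i‖ ≤ ‖stepVec Pop a'‖ :=
    hs.antitone a' i (by rw [Fin.le_def]; omega)
  have h4 : ‖stepVec Pop i‖ / 2 ≤ ‖meanVec (Pop a'.castSucc) - meanVec (Pop b)‖ := by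
    rw [h2]
    exact le_trans (by linarith) h1
  have := pow_le_pow_left₀ (by positivity) h4 2
  simp only [meanGap]
  linarith

lemma trace_covMat_sq_le_iSup (i : Fin (m + 1)) :
    (covMat (Pop i) * covMat (Pop i)).trace ≤
      ⨆ i, (covMat (Pop i) * covMat (Pop i)).trace :=
  le_ciSup (f := fun i => (covMat (Pop i) * covMat (Pop i)).trace) (Set.finite_range _).bddAbove i

lemma abs_dotProduct_covMat_le (i : Fin (m + 1)) (y y' : Vec d) :
    |y.ofLp ⬝ᵥ (covMat (Pop i)).mulVec y'.ofLp| ≤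
      ‖y‖ * ‖y'‖ * √(⨆ i, (covMat (Pop i) * covMat (Pop i)).trace) := by
  refine abs_le_of_sq_le_sq ?_ (by positivity)
  rw [mul_pow, mul_pow, Real.sq_sqrt ((trace_covMat_mul_self_nonneg _).trans
    (trace_covMat_sq_le_iSup i))]
  refine (sq_dotProduct_covMat_mulVec_le _ _ _).trans ?_
  gcongr
  exact trace_covMat_sq_le_iSup i

end Gaps

section StepAsymptotics

variable {m : ℕ} {Pop : (d : ℕ) → Fin (m + 1) → Measure (Vec d)}

lemma eventually_nearlyOrthogonal (hpos : ∀ᶠ d in atTop, 0 < minGap (Pop d))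
    (h5 : MeanStepCondition Pop) : ∀ᶠ d in atTop, NearlyOrthogonal (stepVec (Pop d)) := by
  have hlt : ∀ i j : Fin m, i < j → ∀ᶠ d in atTop,
      ‖stepVec (Pop d) j‖ ≤ ‖stepVec (Pop d) i‖ ∧
      |⟪stepVec (Pop d) i, stepVec (Pop d) j⟫| ≤
        ‖stepVec (Pop d) i‖ * ‖stepVec (Pop d) j‖ / (2 * m) := by
    intro i j hij
    have hm : 0 < (m : ℝ) := by exact_mod_cast i.pos
    obtain ⟨h1, h2⟩ := h5 i j hij
    have h3 := (Real.continuous_cos.tendsto _).comp h1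
    rw [Real.cos_pi_div_two] at h3
    have h4 := h3.abs
    rw [abs_zero] at h4
    filter_upwards [h2.eventually (gt_mem_nhds one_pos),
      h4.eventually (gt_mem_nhds (show 0 < 1 / (2 * (m : ℝ)) by positivity)), hpos]
      with d hd1 hd2 hd3
    have hi : 0 < ‖stepVec (Pop d) i‖ ^ 2 := hd3.trans_le (minGap_le_norm_stepVec i)
    constructor
    · have : ‖stepVec (Pop d) j‖ ^ 2 / ‖stepVec (Pop d) i‖ ^ 2 < 1 := hd1
      rw [div_lt_one hi] at this
      exact le_of_lt (lt_of_pow_lt_pow_left₀ 2 (norm_nonneg _) this)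
    · rw [← InnerProductGeometry.cos_angle_mul_norm_mul_norm, abs_mul,
        abs_of_nonneg (a := ‖stepVec (Pop d) i‖ * ‖stepVec (Pop d) j‖) (by positivity)]
      calc _ ≤ 1 / (2 * (m : ℝ)) * (‖stepVec (Pop d) i‖ * ‖stepVec (Pop d) j‖) := by
            gcongr
            exact hd2.le
        _ = _ := by ring
  have hall : ∀ᶠ d in atTop, ∀ i j : Fin m, i < j →
      ‖stepVec (Pop d) j‖ ≤ ‖stepVec (Pop d) i‖ ∧
      |⟪stepVec (Pop d) i, stepVec (Pop d) j⟫| ≤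
        ‖stepVec (Pop d) i‖ * ‖stepVec (Pop d) j‖ / (2 * m) := by
    simp only [eventually_all]
    exact hlt
  filter_upwards [hall, hpos] with d hd hd0
  refine ⟨fun i h0 => ?_, fun i j hij => ?_, fun i j hij => ?_⟩
  · have := hd0.trans_le (minGap_le_norm_stepVec i)
    simp [h0] at this
  · rcases hij.eq_or_lt with rfl | h
    · exact le_rfl
    · exact (hd i j h).1
  · rcases lt_or_gt_of_ne hij with h | h
    · exact (hd i j h).2
    · rw [real_inner_comm, mul_comm ‖stepVec (Pop d) i‖]
      exact (hd j i h).2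

lemma tendsto_sqrt_trace_div (hpos : ∀ᶠ d in atTop, 0 < minGap (Pop d))
    (h2 : TraceSqCondition Pop) : Tendsto
      (fun d => √(⨆ i, (covMat (Pop d i) * covMat (Pop d i)).trace) / minGap (Pop d))
      atTop (𝓝 0) := by
  have h := (Real.continuous_sqrt.tendsto _).comp h2
  rw [Real.sqrt_zero] at h
  refine h.congr' ?_
  filter_upwards [hpos] with d hd
  rw [Function.comp_apply, Real.sqrt_div' _ (sq_nonneg _), Real.sqrt_sq hd.le]

end StepAsymptotics

lemma Ultrafilter.exists_tendsto_of_abs_le {α : Type*} (U : Ultrafilter α) {f : α → ℝ} {B : ℝ}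
    (h : ∀ᶠ a in (U : Filter α), |f a| ≤ B) : ∃ x, Tendsto f U (𝓝 x) := by
  have hU : ((U.map f : Ultrafilter ℝ) : Filter ℝ) ≤ 𝓟 (Set.Icc (-B) B) := by
    rw [le_principal_iff]
    exact h.mono fun a ha => abs_le.1 ha
  obtain ⟨x, -, hx⟩ := isCompact_Icc.ultrafilter_le_nhds _ hU
  exact ⟨x, hx⟩

section Population

variable {m d : ℕ} {ε : Fin (m + 1) → ℝ} {Pop : Fin (m + 1) → Measure (Vec d)}
  {lam : Fin d → ℝ} {h : Fin d → Vec d}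

/-- The `i`-th eigenvalue of the covariance matrix of the mixture is at least of the order of the
squared length of the `i`-th step. -/
lemma le_eigenvalue_mixture [∀ i, IsProbabilityMeasure (Pop i)] (hε : ∀ i, 0 ≤ ε i)
    (hsum : ∑ i, ε i = 1) (hmom : ∀ i, MemLp (fun x : Vec d => x) 2 (Pop i))
    (hs : NearlyOrthogonal (stepVec Pop)) (hh : IsEigenDecomp (covMat (mixture ε Pop)) lam h)
    {e : ℝ} (he : 0 < e) (heε : ∀ i, e ≤ ε i) (i : Fin m) (hi : (i : ℕ) < d) :
    e / (8 * m ^ 2) * ‖stepVec Pop i‖ ^ 2 ≤ lam ⟨i, hi⟩ := by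
  have hm : 0 < (m : ℝ) := by exact_mod_cast i.pos
  obtain ⟨c, hc0, hcr, hc⟩ := exists_unitComb_orthogonal (stepVec Pop) i
    fun q => h ⟨q, q.2.trans hi⟩
  obtain ⟨p, hpi, hp0, hp⟩ := hs.exists_inner_unitComb hc0 hcr
  set z := unitComb (stepVec Pop) c with hz
  have hznorm : 0 < ‖z‖ ^ 2 := by
    have : z ≠ 0 := fun h0 => hp0 (by rw [h0, inner_zero_left])
    have := norm_pos_iff.2 this
    positivity
  have h1 := hh.quadForm_le z ⟨i, hi⟩ (by
    intro q hq
    exact hc ⟨q, hq⟩)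
  rw [dotProduct_covMat_mixture hε hsum hmom] at h1
  have h2 : 0 ≤ ∑ i, ε i * (z.ofLp ⬝ᵥ (covMat (Pop i)).mulVec z.ofLp) :=
    Finset.sum_nonneg fun i _ =>
      mul_nonneg (hε i) (dotProduct_covMat_mulVec_self_nonneg (hmom i) z)
  have h3 := half_sq_sub_le_sum
    (g := fun a => ⟪z, meanVec (Pop a) - meanVec (mixture ε Pop)⟫) he.le heε p
  have h4 : ⟪z, meanVec (Pop p.castSucc) - meanVec (mixture ε Pop)⟫ -
      ⟪z, meanVec (Pop p.succ) - meanVec (mixture ε Pop)⟫ = ⟪z, stepVec Pop p⟫ := by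
    rw [← inner_sub_right, stepVec]
    congr 1
    abel
  rw [h4] at h3
  have h5 : ∑ a, ε a * ⟪z, meanVec (Pop a) - meanVec (mixture ε Pop)⟫ ^ 2 =
      ∑ a, ε a * ⟪z, meanVec (Pop a) - meanVec (mixture ε Pop)⟫ *
        ⟪z, meanVec (Pop a) - meanVec (mixture ε Pop)⟫ :=
    Finset.sum_congr rfl fun a _ => by ring
  rw [h5] at h3
  refine le_of_mul_le_mul_right ?_ hznorm
  calc e / (8 * m ^ 2) * ‖stepVec Pop i‖ ^ 2 * ‖z‖ ^ 2
      = e / (8 * m ^ 2) * (‖stepVec Pop i‖ ^ 2 * ‖z‖ ^ 2) := by ring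
    _ ≤ e / (8 * m ^ 2) * (4 * m ^ 2 * ⟪z, stepVec Pop p⟫ ^ 2) := by gcongr
    _ = e / 2 * ⟪z, stepVec Pop p⟫ ^ 2 := by field_simp; ring
    _ ≤ _ := by linarith

/-- The mean of the `i`-th normalized principal component score in class `c`. -/
noncomputable def popScore (ε : Fin (m + 1) → ℝ) (Pop : Fin (m + 1) → Measure (Vec d))
    (lam : Fin d → ℝ) (h : Fin d → Vec d) (i : Fin m) (c : Fin (m + 1)) : ℝ :=
  if hi : (i : ℕ) < d then
    ⟪h ⟨i, hi⟩, meanVec (Pop c) - meanVec (mixture ε Pop)⟫ / √(lam ⟨i, hi⟩) else 0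

end Population

section PopulationLimit

variable {m : ℕ} {ε : Fin (m + 1) → ℝ} {Pop : (d : ℕ) → Fin (m + 1) → Measure (Vec d)}
  {lam : (d : ℕ) → Fin d → ℝ} {h : (d : ℕ) → Fin d → Vec d}

lemma tendsto_popScore (hε : ∀ i, 0 < ε i) (hsum : ∑ i, ε i = 1)
    [∀ d i, IsProbabilityMeasure (Pop d i)]
    (hmom : ∀ d i, MemLp (fun x : Vec d => x) 2 (Pop d i))
    (hpos : ∀ᶠ d in atTop, 0 < minGap (Pop d)) (h2 : TraceSqCondition Pop)
    (h5 : MeanStepCondition Pop)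
    (hh : ∀ d, IsEigenDecomp (covMat (mixture ε (Pop d))) (lam d) (h d))
    (hsign : ∀ d (i : Fin m) (hi : (i : ℕ) < d), 0 ≤ ⟪h d ⟨i, hi⟩, stepVec (Pop d) i⟫)
    (i : Fin m) (c : Fin (m + 1)) :
    Tendsto (fun d => popScore ε (Pop d) (lam d) (h d) i c) atTop (𝓝 (weightedScore ε i c)) := by
  have hε0 : ∀ i, 0 ≤ ε i := fun i => (hε i).le
  obtain ⟨e, he, heε⟩ : ∃ e, 0 < e ∧ ∀ i, e ≤ ε i := by
    obtain ⟨i0, -, hi0⟩ := Finset.exists_min_image Finset.univ ε ⟨0, Finset.mem_univ 0⟩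
    exact ⟨ε i0, hε i0, fun i => hi0 i (Finset.mem_univ i)⟩
  have hm : 0 < (m : ℝ) := by exact_mod_cast i.pos
  set κ : ℝ := e / (8 * m ^ 2) with hκ
  have hκ0 : 0 < κ := by positivity
  have hN := tendsto_sqrt_trace_div hpos h2
  have hso := eventually_nearlyOrthogonal hpos h5
  rw [tendsto_iff_ultrafilter]
  intro U hU
  have hlam : ∀ᶠ d in (U : Filter ℕ), ∀ i : Fin m, ∃ hi : (i : ℕ) < d,
      κ * ‖stepVec (Pop d) i‖ ^ 2 ≤ lam d ⟨i, hi⟩ := by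
    apply hU
    filter_upwards [hso, eventually_ge_atTop m] with d hd hdm i
    exact ⟨i.2.trans_le hdm,
      le_eigenvalue_mixture hε0 hsum (hmom d) hd (hh d) he heε i (i.2.trans_le hdm)⟩
  have horth : ∀ i i' : Fin m, Tendsto (fun d => ∑ c, ε c *
      popScore ε (Pop d) (lam d) (h d) i c * popScore ε (Pop d) (lam d) (h d) i' c) U
      (𝓝 (if i = i' then 1 else 0)) := by
    intro i i'
    have hlim := (hN.mono_left hU).const_mul κ⁻¹
    rw [mul_zero] at hlim
    rw [tendsto_iff_norm_sub_tendsto_zero]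
    refine squeeze_zero' (Eventually.of_forall fun _ => norm_nonneg _) ?_ hlim
    filter_upwards [hlam, hU hpos] with d hd hd0
    obtain ⟨hi, hl⟩ := hd i
    obtain ⟨hi', hl'⟩ := hd i'
    have hg : κ * minGap (Pop d) ≤ lam d ⟨i, hi⟩ :=
      le_trans (mul_le_mul_of_nonneg_left (minGap_le_norm_stepVec i) hκ0.le) hl
    have hg' : κ * minGap (Pop d) ≤ lam d ⟨i', hi'⟩ :=
      le_trans (mul_le_mul_of_nonneg_left (minGap_le_norm_stepVec i') hκ0.le) hl'
    have hκg : 0 < κ * minGap (Pop d) := by positivity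
    have hp := hκg.trans_le hg
    have hp' := hκg.trans_le hg'
    set N := √(⨆ i, (covMat (Pop d i) * covMat (Pop d i)).trace) with hNdef
    set D := √(lam d ⟨i, hi⟩) * √(lam d ⟨i', hi'⟩) with hDdef
    have hD : κ * minGap (Pop d) ≤ D := by
      rw [hDdef, ← Real.sqrt_mul hp.le]
      apply Real.le_sqrt_of_sq_le
      rw [sq]
      exact mul_le_mul hg hg' hκg.le hp.le
    have hD0 : 0 < D := hκg.trans_le hD
    have hmix := dotProduct_covMat_mixture hε0 hsum (hmom d) (h d ⟨i, hi⟩) (h d ⟨i', hi'⟩)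
    rw [(hh d).dotProduct_mulVec, orthonormal_iff_ite.1 (hh d).orthonormal] at hmix
    have hA : ∑ c, ε c * popScore ε (Pop d) (lam d) (h d) i c *
        popScore ε (Pop d) (lam d) (h d) i' c =
        (∑ c, ε c * ⟪h d ⟨i, hi⟩, meanVec (Pop d c) - meanVec (mixture ε (Pop d))⟫ *
          ⟪h d ⟨i', hi'⟩, meanVec (Pop d c) - meanVec (mixture ε (Pop d))⟫) / D := by
      rw [Finset.sum_div]
      refine Finset.sum_congr rfl fun c _ => ?_
      rw [popScore, popScore, dif_pos hi, dif_pos hi', hDdef]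
      field_simp
    have hB : (if i = i' then (1 : ℝ) else 0) =
        (lam d ⟨i', hi'⟩ * if (⟨i, hi⟩ : Fin d) = ⟨i', hi'⟩ then 1 else 0) / D := by
      by_cases hii : i = i'
      · subst hii
        rw [if_pos rfl, if_pos rfl, mul_one, hDdef, Real.mul_self_sqrt hp.le, div_self hp.ne']
      · have : (⟨i, hi⟩ : Fin d) ≠ ⟨i', hi'⟩ := fun h0 => hii (Fin.ext (Fin.mk.inj_iff.1 h0))
        rw [if_neg hii, if_neg this]
        simp
    have hC : |∑ c, ε c * ((h d ⟨i, hi⟩).ofLp ⬝ᵥ (covMat (Pop d c)).mulVec (h d ⟨i', hi'⟩).ofLp)|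
        ≤ N := by
      calc _ ≤ ∑ c, |ε c * ((h d ⟨i, hi⟩).ofLp ⬝ᵥ
              (covMat (Pop d c)).mulVec (h d ⟨i', hi'⟩).ofLp)| := Finset.abs_sum_le_sum_abs _ _
        _ ≤ ∑ c, ε c * N := by
            refine Finset.sum_le_sum fun c _ => ?_
            rw [abs_mul, abs_of_nonneg (hε0 c)]
            refine mul_le_mul_of_nonneg_left ?_ (hε0 c)
            have := abs_dotProduct_covMat_le (Pop := Pop d) c (h d ⟨i, hi⟩) (h d ⟨i', hi'⟩)
            rwa [(hh d).orthonormal.1, (hh d).orthonormal.1, one_mul, one_mul] at this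
        _ = N := by rw [← Finset.sum_mul, hsum, one_mul]
    rw [hA, hB, hmix, ← sub_div, Real.norm_eq_abs, abs_div, abs_of_pos hD0, sub_add_cancel_right,
      abs_neg]
    calc _ ≤ N / (κ * minGap (Pop d)) := div_le_div₀ (Real.sqrt_nonneg _) hC hκg hD
      _ = κ⁻¹ * (N / minGap (Pop d)) := by field_simp
  have hbound : ∀ (i : Fin m) (c : Fin (m + 1)), ∃ x,
      Tendsto (fun d => popScore ε (Pop d) (lam d) (h d) i c) U (𝓝 x) := by
    intro i c
    refine U.exists_tendsto_of_abs_le (B := 2 / e + 1) ?_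
    have h1 := horth i i
    rw [if_pos rfl] at h1
    filter_upwards [h1.eventually (gt_mem_nhds one_lt_two)] with d hd
    have h3 : ε c * popScore ε (Pop d) (lam d) (h d) i c * popScore ε (Pop d) (lam d) (h d) i c
        ≤ ∑ c, ε c * popScore ε (Pop d) (lam d) (h d) i c *
          popScore ε (Pop d) (lam d) (h d) i c :=
      Finset.single_le_sum (f := fun c => ε c * popScore ε (Pop d) (lam d) (h d) i c *
        popScore ε (Pop d) (lam d) (h d) i c)
        (fun c _ => by rw [mul_assoc]; exact mul_nonneg (hε0 c) (mul_self_nonneg _))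
        (Finset.mem_univ c)
    set x := popScore ε (Pop d) (lam d) (h d) i c
    have h4 : x ^ 2 ≤ 2 / e := by
      rw [le_div_iff₀ he]
      nlinarith [mul_le_mul_of_nonneg_right (heε c) (sq_nonneg x)]
    have h6 : |x| ^ 2 = x ^ 2 := sq_abs x
    nlinarith [sq_nonneg (|x| - 1)]
  choose g hg using hbound
  have hcore := eq_or_eq_neg_weightedScore hε hsum (g := g)
    (fun i i' => tendsto_nhds_unique
      (tendsto_finsetSum _ fun c _ => ((hg i c).const_mul (ε c)).mul (hg i' c)) (horth i i'))
    (fun i => by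
      refine tendsto_nhds_unique (tendsto_finsetSum _ fun c _ => (hg i c).const_mul (ε c))
        (tendsto_const_nhds.congr' ?_)
      filter_upwards [hlam] with d hd
      obtain ⟨hi, -⟩ := hd i
      have h1 := sum_inner_meanVec_sub hε0 hsum (hmom d) (h d ⟨i, hi⟩)
      simp_rw [popScore, dif_pos hi, ← mul_div_assoc, ← Finset.sum_div, h1, zero_div])
    (fun i c hic => by
      have hdiff := (hg i c.castSucc).sub (hg i c.succ)
      have hzero : Tendsto (fun d => popScore ε (Pop d) (lam d) (h d) i c.castSucc -
          popScore ε (Pop d) (lam d) (h d) i c.succ) U (𝓝 0) := by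
        have hr := (((h5 i c hic).2.mono_left hU).const_mul κ⁻¹).sqrt
        rw [mul_zero, Real.sqrt_zero] at hr
        refine squeeze_zero_norm' ?_ hr
        filter_upwards [hlam, hU hpos] with d hd hd0
        obtain ⟨hi, hl⟩ := hd i
        have hσ : 0 < ‖stepVec (Pop d) i‖ ^ 2 := hd0.trans_le (minGap_le_norm_stepVec i)
        have hp : 0 < lam d ⟨i, hi⟩ := lt_of_lt_of_le (by positivity) hl
        rw [popScore, popScore, dif_pos hi, dif_pos hi, ← sub_div, ← inner_sub_right,
          sub_sub_sub_cancel_right]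
        change ‖⟪h d ⟨i, hi⟩, stepVec (Pop d) c⟫ / _‖ ≤
          √(κ⁻¹ * (‖stepVec (Pop d) c‖ ^ 2 / ‖stepVec (Pop d) i‖ ^ 2))
        apply Real.le_sqrt_of_sq_le
        rw [Real.norm_eq_abs, sq_abs, div_pow, Real.sq_sqrt hp.le]
        have hcs : ⟪h d ⟨i, hi⟩, stepVec (Pop d) c⟫ ^ 2 ≤ ‖stepVec (Pop d) c‖ ^ 2 := by
          have := abs_real_inner_le_norm (h d ⟨i, hi⟩) (stepVec (Pop d) c)
          rw [(hh d).orthonormal.1, one_mul] at this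
          rw [← sq_abs]
          gcongr
        calc _ ≤ ‖stepVec (Pop d) c‖ ^ 2 / (κ * ‖stepVec (Pop d) i‖ ^ 2) := by gcongr
          _ = _ := by field_simp
      exact sub_eq_zero.1 (tendsto_nhds_unique hdiff hzero)) i
  rcases hcore with hc | hc
  · rw [← hc]
    exact hg i c
  · exfalso
    have h1 : 0 ≤ g i i.castSucc - g i i.succ := by
      refine ge_of_tendsto ((hg i i.castSucc).sub (hg i i.succ)) ?_
      filter_upwards [hlam] with d hd
      obtain ⟨hi, -⟩ := hd i
      rw [popScore, popScore, dif_pos hi, dif_pos hi, ← sub_div, ← inner_sub_right,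
        sub_sub_sub_cancel_right]
      exact div_nonneg (hsign d i hi) (Real.sqrt_nonneg _)
    rw [hc, hc] at h1
    have h3 := weightedScore_castSucc_pos hε hsum i
    have h4 := weightedScore_nonpos ε i i.succ Fin.castSucc_lt_succ.ne'
    linarith

end PopulationLimit

section DualSample

variable {n d : ℕ} {x : Fin n → Vec d}

lemma sum_sub_sampleMean (hn : 0 < n) (x : Fin n → Vec d) : ∑ j, (x j - sampleMean x) = 0 := by
  have : (n : ℝ) ≠ 0 := by positivity
  rw [Finset.sum_sub_distrib, Finset.sum_const, Finset.card_univ, Fintype.card_fin, sampleMean,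
    ← Nat.cast_smul_eq_nsmul ℝ, smul_inv_smul₀ this, sub_self]

lemma dotProduct_dualCov (hn : 2 ≤ n) (v v' : Vec n) :
    ((n : ℝ) - 1) * (v.ofLp ⬝ᵥ (dualCov x).mulVec v'.ofLp) =
      ⟪∑ j, v j • (x j - sampleMean x), ∑ j, v' j • (x j - sampleMean x)⟫ := by
  have hn' : (n : ℝ) - 1 ≠ 0 := by
    have : (2 : ℝ) ≤ n := by exact_mod_cast hn
    linarith
  simp_rw [sum_inner, inner_sum, real_inner_smul_left, real_inner_smul_right, dotProduct,
    Matrix.mulVec, dotProduct, dualCov, Matrix.of_apply, Finset.mul_sum]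
  refine Finset.sum_congr rfl fun a _ => Finset.sum_congr rfl fun b _ => ?_
  field_simp

lemma sum_smul_sub_eq {v : Vec n} (hv : ∑ j, v j = 0) (x : Fin n → Vec d) (r r' : Vec d) :
    ∑ j, v j • (x j - r) = ∑ j, v j • (x j - r') := by
  have : ∀ r, ∑ j, v j • (x j - r) = ∑ j, v j • x j := fun r => by
    simp_rw [smul_sub, Finset.sum_sub_distrib]
    rw [← Finset.sum_smul, hv, zero_smul, sub_zero]
  rw [this, this]

/-- Eigenvectors of the dual covariance matrix with nonzero eigenvalue are centred. -/
lemma sum_eigenvector_dualCov (hn : 2 ≤ n) {lam : Fin n → ℝ} {u : Fin n → Vec n}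
    (hu : IsEigenDecomp (dualCov x) lam u) {r : Fin n} (hr : lam r ≠ 0) : ∑ j, u r j = 0 := by
  have hn' : (n : ℝ) - 1 ≠ 0 := by
    have : (2 : ℝ) ≤ n := by exact_mod_cast hn
    linarith
  have h1 := dotProduct_dualCov (x := x) hn (WithLp.toLp 2 fun _ => (1 : ℝ)) (u r)
  rw [hu.dotProduct_mulVec] at h1
  simp only [one_smul, sum_sub_sampleMean (show 0 < n by omega) x, inner_zero_left] at h1
  have h2 := ((mul_eq_zero.1 h1).resolve_left hn')
  have h3 := (mul_eq_zero.1 h2).resolve_left hr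
  simpa [inner_eq_sum_mul] using h3

lemma abs_sum_sum_mul_le (v v' : Vec n) (e : Fin n → Fin n → ℝ) :
    |∑ j, ∑ j', v j * v' j' * e j j'| ≤ ‖v‖ * ‖v'‖ * ∑ j, ∑ j', |e j j'| := by
  rw [Finset.mul_sum]
  refine (Finset.abs_sum_le_sum_abs _ _).trans (Finset.sum_le_sum fun j _ => ?_)
  rw [Finset.mul_sum]
  refine (Finset.abs_sum_le_sum_abs _ _).trans (Finset.sum_le_sum fun j' _ => ?_)
  rw [abs_mul, abs_mul]
  have h1 : |v j| ≤ ‖v‖ := by simpa using PiLp.norm_apply_le v j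
  have h2 : |v' j'| ≤ ‖v'‖ := by simpa using PiLp.norm_apply_le v' j'
  gcongr

/-- The deviation of the Gram matrix of `x j - r` from that of `M j` plus `t` times the identity. -/
noncomputable def gramError (x M : Fin n → Vec d) (r : Vec d) (t : ℝ) (j j' : Fin n) : ℝ :=
  ⟪x j - r, x j' - r⟫ - ⟪M j, M j'⟫ - if j = j' then t else 0

lemma abs_dualCov_sub_le (hn : 2 ≤ n) {v v' : Vec n} (hv : ∑ j, v j = 0) (hv' : ∑ j, v' j = 0)
    (M : Fin n → Vec d) (r : Vec d) (t : ℝ) :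
    |((n : ℝ) - 1) * (v.ofLp ⬝ᵥ (dualCov x).mulVec v'.ofLp) -
      ⟪∑ j, v j • M j, ∑ j, v' j • M j⟫ - t * ⟪v, v'⟫| ≤
      ‖v‖ * ‖v'‖ * ∑ j, ∑ j', |gramError x M r t j j'| := by
  refine le_trans (le_of_eq ?_) (abs_sum_sum_mul_le v v' _)
  rw [dotProduct_dualCov hn, sum_smul_sub_eq hv x _ r, sum_smul_sub_eq hv' x _ r]
  congr 1
  have h1 : t * ⟪v, v'⟫ = ∑ j, ∑ j', v j * v' j' * if j = j' then t else 0 := by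
    rw [inner_eq_sum_mul, Finset.mul_sum]
    refine Finset.sum_congr rfl fun j _ => ?_
    simp only [mul_ite, mul_zero, Finset.sum_ite_eq, Finset.mem_univ, if_true]
    ring
  have h2 : ∀ z : Fin n → Vec d, ⟪∑ j, v j • z j, ∑ j, v' j • z j⟫ =
      ∑ j, ∑ j', v j * v' j' * ⟪z j, z j'⟫ := by
    intro z
    simp_rw [sum_inner, inner_sum, real_inner_smul_left, real_inner_smul_right]
    refine Finset.sum_congr rfl fun j _ => Finset.sum_congr rfl fun j' _ => ?_
    ring
  rw [h2, h2, h1, ← Finset.sum_sub_distrib, ← Finset.sum_sub_distrib]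
  refine Finset.sum_congr rfl fun j _ => ?_
  rw [← Finset.sum_sub_distrib, ← Finset.sum_sub_distrib]
  refine Finset.sum_congr rfl fun j' _ => ?_
  rw [gramError]
  ring

end DualSample

section DualEigen

variable {m n d : ℕ} {x : Fin n → Vec d} {l : Fin n → Fin (m + 1)} {μ : Fin (m + 1) → Vec d}
  {lam : Fin n → ℝ} {u : Fin n → Vec n} {r₀ : Vec d} {t : ℝ}

/-- The `i`-th eigenvalue of the dual covariance matrix exceeds the common noise level by at least
the order of the squared length of the `i`-th step. -/
lemma le_eigenvalue_dualCov (hn : 2 ≤ n) (hl : Function.Surjective l)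
    (hs : NearlyOrthogonal fun i : Fin m => μ i.castSucc - μ i.succ)
    (hu : IsEigenDecomp (dualCov x) lam u) (i : Fin m) (hi : (i : ℕ) < n) :
    1 / (8 * (m : ℝ) ^ 2) * ‖μ i.castSucc - μ i.succ‖ ^ 2 -
      ∑ j, ∑ j', |gramError x (fun j => μ (l j) - r₀) r₀ t j j'| ≤
        ((n : ℝ) - 1) * lam ⟨i, hi⟩ - t := by
  have hm : 0 < (m : ℝ) := by exact_mod_cast i.pos
  have hn0 : (n : ℝ) ≠ 0 := by
    have : (2 : ℝ) ≤ n := by exact_mod_cast hn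
    positivity
  have hn1 : (0 : ℝ) ≤ (n : ℝ) - 1 := by
    have : (2 : ℝ) ≤ n := by exact_mod_cast hn
    linarith
  set M : Fin n → Vec d := fun j => μ (l j) - r₀ with hM
  set Mb : Vec d := sampleMean M
  set s : Fin m → Vec d := fun i => μ i.castSucc - μ i.succ with hsdef
  set η := ∑ j, ∑ j', |gramError x M r₀ t j j'| with hη
  obtain ⟨c, hc0, hcr, hc⟩ := exists_unitComb_orthogonal s i
    fun q => ∑ j, u ⟨q, q.2.trans hi⟩ j • (M j - Mb)
  obtain ⟨p, hpi, hp0, hp⟩ := hs.exists_inner_unitComb hc0 hcr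
  set z := unitComb s c with hz
  let v : Vec n := WithLp.toLp 2 fun j => ⟪M j - Mb, z⟫
  have hv : ∀ j, v j = ⟪M j - Mb, z⟫ := fun j => rfl
  have hv0 : ∑ j, v j = 0 := by
    simp_rw [hv]
    rw [← sum_inner, sum_sub_sampleMean (by omega), inner_zero_left]
  have hMv : ⟪∑ j, v j • M j, z⟫ = ‖v‖ ^ 2 := by
    have := sum_smul_sub_eq hv0 M 0 Mb
    simp only [sub_zero] at this
    rw [this, sum_inner, EuclideanSpace.real_norm_sq_eq]
    refine Finset.sum_congr rfl fun j _ => ?_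
    rw [real_inner_smul_left, ← hv, sq]
  have hvp : 1 / 2 * ⟪z, s p⟫ ^ 2 ≤ ‖v‖ ^ 2 := by
    obtain ⟨j, hj⟩ := hl p.castSucc
    obtain ⟨j', hj'⟩ := hl p.succ
    have hjj : j ≠ j' := by
      rintro rfl
      rw [hj] at hj'
      exact Fin.castSucc_lt_succ.ne hj'
    have h1 : v j - v j' = ⟪z, s p⟫ := by
      rw [hv, hv, ← inner_sub_left, sub_sub_sub_cancel_right, hM]
      simp only [hj, hj', sub_sub_sub_cancel_right]
      rw [real_inner_comm]
    have h2 : ∑ a ∈ {j, j'}, v a ^ 2 ≤ ∑ a, v a ^ 2 :=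
      Finset.sum_le_sum_of_subset_of_nonneg (Finset.subset_univ _) fun a _ _ => sq_nonneg _
    rw [Finset.sum_pair hjj] at h2
    rw [EuclideanSpace.real_norm_sq_eq, ← h1]
    nlinarith [sq_nonneg (v j + v j')]
  have hvpos : 0 < ‖v‖ ^ 2 := lt_of_lt_of_le (by positivity) hvp
  have h3 : ‖s i‖ ^ 2 * ‖v‖ ^ 2 ≤ 8 * (m : ℝ) ^ 2 * ‖∑ j, v j • M j‖ ^ 2 := by
    have h4 := abs_real_inner_le_norm (∑ j, v j • M j) z
    rw [hMv, abs_of_pos hvpos] at h4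
    have h5 := pow_le_pow_left₀ hvpos.le h4 2
    refine le_of_mul_le_mul_right ?_ hvpos
    calc ‖s i‖ ^ 2 * ‖v‖ ^ 2 * ‖v‖ ^ 2 = ‖s i‖ ^ 2 * (‖v‖ ^ 2) ^ 2 := by ring
      _ ≤ ‖s i‖ ^ 2 * (‖∑ j, v j • M j‖ * ‖z‖) ^ 2 := by gcongr
      _ = ‖∑ j, v j • M j‖ ^ 2 * (‖s i‖ ^ 2 * ‖z‖ ^ 2) := by ring
      _ ≤ ‖∑ j, v j • M j‖ ^ 2 * (4 * m ^ 2 * ⟪z, s p⟫ ^ 2) := by gcongr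
      _ ≤ ‖∑ j, v j • M j‖ ^ 2 * (4 * m ^ 2 * (2 * ‖v‖ ^ 2)) := by
          gcongr
          linarith
      _ = _ := by ring
  have h6 := hu.quadForm_le v ⟨i, hi⟩ (by
    intro q hq
    have := hc ⟨q, hq⟩
    rw [sum_inner] at this
    rw [inner_eq_sum_mul, ← this]
    refine Finset.sum_congr rfl fun j _ => ?_
    rw [real_inner_smul_left, hv])
  have h7 := (abs_le.1 (abs_dualCov_sub_le (x := x) hn hv0 hv0 M r₀ t)).1
  rw [real_inner_self_eq_norm_sq, real_inner_self_eq_norm_sq, ← hη] at h7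
  have h8 := mul_le_mul_of_nonneg_left h6 hn1
  refine le_of_mul_le_mul_right ?_ hvpos
  have h9 : 1 / (8 * (m : ℝ) ^ 2) * ‖s i‖ ^ 2 * ‖v‖ ^ 2 ≤ ‖∑ j, v j • M j‖ ^ 2 := by
    rw [mul_assoc, one_div_mul_eq_div, div_le_iff₀ (by positivity)]
    linarith
  change (1 / (8 * (m : ℝ) ^ 2) * ‖s i‖ ^ 2 - η) * ‖v‖ ^ 2 ≤ _
  nlinarith

/-- Differences of the coordinates of the leading eigenvectors of the dual covariance matrix. -/
lemma abs_eigenvector_sub_le (hn : 2 ≤ n) (hl : Function.Surjective l)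
    (hs : NearlyOrthogonal fun i : Fin m => μ i.castSucc - μ i.succ)
    (hu : IsEigenDecomp (dualCov x) lam u) (ht : 0 ≤ t) (i : Fin m) (hi : (i : ℕ) < n)
    (hη : ∑ j, ∑ j', |gramError x (fun j => μ (l j) - r₀) r₀ t j j'| ≤
      1 / (16 * (m : ℝ) ^ 2) * ‖μ i.castSucc - μ i.succ‖ ^ 2) :
    ∑ j, u ⟨i, hi⟩ j = 0 ∧ ∀ j j', |u ⟨i, hi⟩ j - u ⟨i, hi⟩ j'| ≤
      32 * (m : ℝ) ^ 2 * (‖μ (l j) - μ (l j')‖ / ‖μ i.castSucc - μ i.succ‖ +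
        (∑ j, ∑ j', |gramError x (fun j => μ (l j) - r₀) r₀ t j j'|) /
          ‖μ i.castSucc - μ i.succ‖ ^ 2) := by
  have hm : 1 ≤ (m : ℝ) := by exact_mod_cast i.pos
  have hn1 : (0 : ℝ) < (n : ℝ) - 1 := by
    have : (2 : ℝ) ≤ n := by exact_mod_cast hn
    linarith
  have hlow := le_eigenvalue_dualCov (r₀ := r₀) (t := t) hn hl hs hu i hi
  have hσ : 0 < ‖μ i.castSucc - μ i.succ‖ := hs.norm_pos i
  set σ := ‖μ i.castSucc - μ i.succ‖
  set M : Fin n → Vec d := fun j => μ (l j) - r₀ with hM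
  set η := ∑ j, ∑ j', |gramError x M r₀ t j j'| with hηdef
  set κ := ((n : ℝ) - 1) * lam ⟨i, hi⟩ - t with hκ
  set w := u ⟨i, hi⟩ with hw
  have hκlow : 1 / (16 * (m : ℝ) ^ 2) * σ ^ 2 ≤ κ := by
    have : 1 / (8 * (m : ℝ) ^ 2) * σ ^ 2 = 2 * (1 / (16 * (m : ℝ) ^ 2) * σ ^ 2) := by
      field_simp; ring
    linarith
  have hκ0 : 0 < κ := lt_of_lt_of_le (by positivity) hκlow
  have hlam : lam ⟨i, hi⟩ ≠ 0 := by
    intro h0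
    rw [h0, mul_zero] at hκ
    linarith
  have hw0 : ∑ j, w j = 0 := sum_eigenvector_dualCov hn hu hlam
  refine ⟨hw0, fun j j' => ?_⟩
  have hη0 : 0 ≤ η := Finset.sum_nonneg fun _ _ => Finset.sum_nonneg fun _ _ => abs_nonneg _
  have hw1 : ‖w‖ = 1 := hu.orthonormal.1 _
  have hMw : ‖∑ j, w j • M j‖ ^ 2 ≤ 2 * κ := by
    have h7 := (abs_le.1 (abs_dualCov_sub_le (x := x) hn hw0 hw0 M r₀ t)).1
    rw [hu.dotProduct_mulVec, real_inner_self_eq_norm_sq, real_inner_self_eq_norm_sq, hw1, ← hηdef]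
      at h7
    linarith
  let v : Vec n := EuclideanSpace.single j 1 - EuclideanSpace.single j' 1
  have hv : ‖v‖ ≤ 2 := (norm_sub_le _ _).trans (by simp; norm_num)
  have hv0 : ∑ a, v a = 0 := by simp [v, Finset.sum_sub_distrib]
  have hvw : ⟪v, w⟫ = w j - w j' := by
    simp [v, inner_sub_left, EuclideanSpace.inner_single_left]
  have hvM : ∑ a, v a • M a = μ (l j) - μ (l j') := by
    simp [v, sub_smul, Finset.sum_sub_distrib, hM]
  have h8 := abs_dualCov_sub_le (x := x) hn hv0 hw0 M r₀ t
  rw [hu.dotProduct_mulVec, hvw, hvM, hw1, ← hηdef, mul_one] at h8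
  have h9 : |κ * (w j - w j')| ≤ ‖μ (l j) - μ (l j')‖ * ‖∑ j, w j • M j‖ + 2 * η := by
    have e : κ * (w j - w j') = ⟪μ (l j) - μ (l j'), ∑ j, w j • M j⟫ +
        (((n : ℝ) - 1) * (lam ⟨i, hi⟩ * (w j - w j')) - ⟪μ (l j) - μ (l j'), ∑ j, w j • M j⟫ -
          t * (w j - w j')) := by rw [hκ]; ring
    rw [e]
    refine (abs_add_le _ _).trans (add_le_add (abs_real_inner_le_norm _ _) (h8.trans ?_))
    gcongr
  have h10 : σ * ‖∑ j, w j • M j‖ ≤ 8 * m * κ := by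
    refine (sq_le_sq₀ (by positivity) (by positivity)).1 ?_
    have : σ ^ 2 ≤ 16 * (m : ℝ) ^ 2 * κ := by
      rw [one_div_mul_eq_div, div_le_iff₀ (by positivity)] at hκlow
      linarith
    calc (σ * ‖∑ j, w j • M j‖) ^ 2 = σ ^ 2 * ‖∑ j, w j • M j‖ ^ 2 := by ring
      _ ≤ (16 * (m : ℝ) ^ 2 * κ) * (2 * κ) := by gcongr
      _ ≤ (8 * m * κ) ^ 2 := by nlinarith [sq_nonneg (m * κ)]
  have h11 : σ ^ 2 ≤ 16 * (m : ℝ) ^ 2 * κ := by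
    rw [one_div_mul_eq_div, div_le_iff₀ (by positivity)] at hκlow
    linarith
  rw [abs_mul, abs_of_pos hκ0] at h9
  refine le_of_mul_le_mul_left ?_ hκ0
  refine h9.trans ?_
  have hD : 0 ≤ ‖μ (l j) - μ (l j')‖ := norm_nonneg _
  set D := ‖μ (l j) - μ (l j')‖
  have h12 : D * ‖∑ j, w j • M j‖ ≤ κ * (32 * m ^ 2 * (D / σ)) := by
    calc D * ‖∑ j, w j • M j‖ = D / σ * (σ * ‖∑ j, w j • M j‖) := by field_simp
      _ ≤ D / σ * (32 * m ^ 2 * κ) := by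
          refine mul_le_mul_of_nonneg_left (h10.trans ?_) (by positivity)
          refine mul_le_mul_of_nonneg_right ?_ hκ0.le
          nlinarith
      _ = _ := by ring
  have h13 : 2 * η ≤ κ * (32 * m ^ 2 * (η / σ ^ 2)) := by
    calc 2 * η = η / σ ^ 2 * (2 * σ ^ 2) := by field_simp
      _ ≤ η / σ ^ 2 * (2 * (16 * (m : ℝ) ^ 2 * κ)) := by gcongr
      _ = _ := by ring
  linarith

end DualEigen

section Noise

variable {m n : ℕ} {Pop : (d : ℕ) → Fin (m + 1) → Measure (Vec d)}
  [∀ d i, IsProbabilityMeasure (Pop d i)] {l : Fin n → Fin (m + 1)}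
  {Ω : ℕ → Type*} [∀ d, MeasurableSpace (Ω d)] {Q : (d : ℕ) → Measure (Ω d)}
  [∀ d, IsProbabilityMeasure (Q d)] {X : (d : ℕ) → Fin n → Ω d → Vec d}

lemma tendsto_inner_step_noise (hmom : ∀ d i, MemLp (fun x : Vec d => x) 2 (Pop d i))
    (hpos : ∀ᶠ d in atTop, 0 < minGap (Pop d)) (h2 : TraceSqCondition Pop)
    (h5 : MeanStepCondition Pop) (h6 : StepVarianceCondition Pop)
    (hX : ∀ d j, Measurable (X d j)) (hmap : ∀ d j, (Q d).map (X d j) = Pop d (l j))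
    (i : Fin m) (j : Fin n) :
    Tendsto (fun p : Σ d, Ω d =>
      ⟪stepVec (Pop p.1) i, X p.1 j p.2 - meanVec (Pop p.1 (l j))⟫ / minGap (Pop p.1))
      (probFilter Q) (𝓝 0) := by
  have hint : ∀ d, Integrable
      (fun ω => ⟪stepVec (Pop d) i, X d j ω - meanVec (Pop d (l j))⟫ ^ 2) (Q d) := fun d =>
    integrable_sq_inner_obs (hX d j) (hmap d j) (hmom d _) _
  by_cases hi : (i : ℕ) + 1 < m
  · refine tendsto_probFilter_of_sq (Q := Q) (b := fun d => minGap (Pop d))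
      (f := fun d ω => ⟪stepVec (Pop d) i, X d j ω - meanVec (Pop d (l j))⟫)
      (V := fun d => ⨆ q : {i : Fin m // (i : ℕ) + 1 < m} × Fin (m + 1),
        (stepVec (Pop d) q.1.1).ofLp ⬝ᵥ
          (covMat (Pop d q.2)).mulVec (stepVec (Pop d) q.1.1).ofLp)
      (Eventually.of_forall hint) (Eventually.of_forall fun d => ?_) h6
    rw [integral_sq_inner_obs (hX d j) (hmap d j) (hmom d _)]
    exact le_ciSup (f := fun q : {i : Fin m // (i : ℕ) + 1 < m} × Fin (m + 1) =>
      (stepVec (Pop d) q.1.1).ofLp ⬝ᵥ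
        (covMat (Pop d q.2)).mulVec (stepVec (Pop d) q.1.1).ofLp)
      (Set.finite_range _).bddAbove (⟨i, hi⟩, l j)
  · refine tendsto_probFilter_of_sq (Q := Q) (b := fun d => minGap (Pop d))
      (f := fun d ω => ⟪stepVec (Pop d) i, X d j ω - meanVec (Pop d (l j))⟫)
      (V := fun d => 4 * minGap (Pop d) *
        √(⨆ i, (covMat (Pop d i) * covMat (Pop d i)).trace))
      (Eventually.of_forall hint) ?_ ?_
    · filter_upwards [eventually_nearlyOrthogonal hpos h5] with d hd
      rw [integral_sq_inner_obs (hX d j) (hmap d j) (hmom d _)]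
      refine (le_abs_self _).trans ((abs_dotProduct_covMat_le _ _ _).trans ?_)
      rw [← sq]
      gcongr
      exact norm_stepVec_le_minGap hd i (by omega)
    · have h := (tendsto_sqrt_trace_div hpos h2).const_mul 4
      rw [mul_zero] at h
      refine h.congr' ?_
      filter_upwards [hpos] with d hd
      field_simp

lemma tendsto_inner_noise_noise (hmom : ∀ d i, MemLp (fun x : Vec d => x) 2 (Pop d i))
    (h2 : TraceSqCondition Pop)
    (hX : ∀ d j, Measurable (X d j)) (hmap : ∀ d j, (Q d).map (X d j) = Pop d (l j))
    (hind : ∀ d, iIndepFun (X d) (Q d)) {j j' : Fin n} (hj : j ≠ j') :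
    Tendsto (fun p : Σ d, Ω d => ⟪X p.1 j p.2 - meanVec (Pop p.1 (l j)),
      X p.1 j' p.2 - meanVec (Pop p.1 (l j'))⟫ / minGap (Pop p.1)) (probFilter Q) (𝓝 0) := by
  have h := fun d => integral_sq_inner_obs_obs (hX d j) (hX d j') (hmap d j) (hmap d j')
    (hmom d _) (hmom d _) ((hind d).indepFun hj)
  refine tendsto_probFilter_of_sq (Q := Q) (b := fun d => minGap (Pop d))
    (f := fun d ω => ⟪X d j ω - meanVec (Pop d (l j)), X d j' ω - meanVec (Pop d (l j'))⟫)
    (V := fun d => ⨆ i, (covMat (Pop d i) * covMat (Pop d i)).trace)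
    (Eventually.of_forall fun d => (h d).1) (Eventually.of_forall fun d => ?_) h2
  rw [(h d).2]
  refine (trace_covMat_mul_le _ _).trans ?_
  have h1 := trace_covMat_sq_le_iSup (Pop := Pop d) (l j)
  have h3 := trace_covMat_sq_le_iSup (Pop := Pop d) (l j')
  linarith

lemma tendsto_norm_sq_noise (hmom : ∀ d i, MemLp (fun x : Vec d => x) 2 (Pop d i))
    (h3 : NormVarianceCondition Pop) (h4 : TraceCondition Pop)
    (hX : ∀ d j, Measurable (X d j)) (hmap : ∀ d j, (Q d).map (X d j) = Pop d (l j))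
    (j : Fin n) :
    Tendsto (fun p : Σ d, Ω d => (‖X p.1 j p.2 - meanVec (Pop p.1 (l j))‖ ^ 2 -
      (covMat (Pop p.1 0)).trace) / minGap (Pop p.1)) (probFilter Q) (𝓝 0) := by
  have h1 : Tendsto (fun p : Σ d, Ω d => (‖X p.1 j p.2 - meanVec (Pop p.1 (l j))‖ ^ 2 -
      (covMat (Pop p.1 (l j))).trace) / minGap (Pop p.1)) (probFilter Q) (𝓝 0) := by
    refine tendsto_probFilter_of_sq (Q := Q) (b := fun d => minGap (Pop d))
      (f := fun d ω => ‖X d j ω - meanVec (Pop d (l j))‖ ^ 2 - (covMat (Pop d (l j))).trace)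
      (V := fun d => ⨆ i, Var[fun x => ‖x - meanVec (Pop d i)‖ ^ 2; Pop d i])
      ?_ (Eventually.of_forall fun d => ?_) h3.2
    · filter_upwards [h3.1] with d hd
      exact integrable_sq_norm_sq_obs (hX d j) (hmap d j) (hd _) _
    · rw [integral_sq_norm_sq_obs (hX d j) (hmap d j) (hmom d _)]
      exact le_ciSup (f := fun i => Var[fun x => ‖x - meanVec (Pop d i)‖ ^ 2; Pop d i])
        (Set.finite_range _).bddAbove (l j)
  have h0 : Tendsto (fun d => ((covMat (Pop d (l j))).trace - (covMat (Pop d 0)).trace) /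
      minGap (Pop d)) atTop (𝓝 0) := by
    rcases eq_or_ne (l j) 0 with h | h
    · simp [h]
    · have := (h4 0 (l j) (Fin.pos_of_ne_zero h)).neg
      rw [neg_zero] at this
      refine this.congr fun d => ?_
      rw [← neg_div, neg_sub]
  have := h1.add (h0.comp (tendsto_fst_probFilter (Q := Q)))
  rw [add_zero] at this
  refine this.congr fun p => ?_
  rw [Function.comp_apply, ← add_div, sub_add_sub_cancel]

/-- The Gram matrix of the observations is, up to errors that are negligible with respect to the
smallest gap, the sum of that of the class means and of a multiple of the identity. -/
lemma tendsto_gramError (hmom : ∀ d i, MemLp (fun x : Vec d => x) 2 (Pop d i))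
    (hpos : ∀ᶠ d in atTop, 0 < minGap (Pop d)) (h2 : TraceSqCondition Pop)
    (h3 : NormVarianceCondition Pop) (h4 : TraceCondition Pop)
    (h5 : MeanStepCondition Pop) (h6 : StepVarianceCondition Pop)
    (hX : ∀ d j, Measurable (X d j)) (hmap : ∀ d j, (Q d).map (X d j) = Pop d (l j))
    (hind : ∀ d, iIndepFun (X d) (Q d)) :
    Tendsto (fun p : Σ d, Ω d => (∑ j, ∑ j', |gramError (fun j => X p.1 j p.2)
      (fun j => meanVec (Pop p.1 (l j)) - meanVec (Pop p.1 (Fin.last m)))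
      (meanVec (Pop p.1 (Fin.last m))) (covMat (Pop p.1 0)).trace j j'|) / minGap (Pop p.1))
      (probFilter Q) (𝓝 0) := by
  have hM : ∀ a j, Tendsto (fun p : Σ d, Ω d =>
      ⟪meanVec (Pop p.1 a) - meanVec (Pop p.1 (Fin.last m)),
        X p.1 j p.2 - meanVec (Pop p.1 (l j))⟫ / minGap (Pop p.1)) (probFilter Q) (𝓝 0) := by
    intro a j
    have := tendsto_finsetSum (Finset.univ.filter
      (fun i : Fin m => a ≤ i.castSucc ∧ i.castSucc < Fin.last m)) fun i _ =>
        tendsto_inner_step_noise hmom hpos h2 h5 h6 hX hmap i j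
    rw [Finset.sum_const_zero] at this
    refine this.congr fun p => ?_
    rw [sub_eq_sum_steps (fun c => meanVec (Pop p.1 c)) a _ (Fin.le_last a), sum_inner,
      Finset.sum_div]
    rfl
  have hjj : ∀ j j', Tendsto (fun p : Σ d, Ω d => |gramError (fun j => X p.1 j p.2)
      (fun j => meanVec (Pop p.1 (l j)) - meanVec (Pop p.1 (Fin.last m)))
      (meanVec (Pop p.1 (Fin.last m))) (covMat (Pop p.1 0)).trace j j'| / minGap (Pop p.1))
      (probFilter Q) (𝓝 0) := by
    intro j j'
    have hww : Tendsto (fun p : Σ d, Ω d => (⟪X p.1 j p.2 - meanVec (Pop p.1 (l j)),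
        X p.1 j' p.2 - meanVec (Pop p.1 (l j'))⟫ -
          if j = j' then (covMat (Pop p.1 0)).trace else 0) / minGap (Pop p.1))
        (probFilter Q) (𝓝 0) := by
      by_cases h : j = j'
      · subst h
        simpa [real_inner_self_eq_norm_sq] using tendsto_norm_sq_noise hmom h3 h4 hX hmap j
      · simpa [h] using tendsto_inner_noise_noise hmom h2 hX hmap hind h
    have hsum := (((hM (l j) j').add (hM (l j') j)).add hww).abs
    simp only [add_zero, abs_zero] at hsum
    refine hsum.congr' ?_
    filter_upwards [tendsto_fst_probFilter.eventually hpos] with p hp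
    rw [← add_div, ← add_div, abs_div, abs_of_pos hp, gramError]
    congr 2
    have e : ∀ j, X p.1 j p.2 - meanVec (Pop p.1 (Fin.last m)) =
        (meanVec (Pop p.1 (l j)) - meanVec (Pop p.1 (Fin.last m))) +
          (X p.1 j p.2 - meanVec (Pop p.1 (l j))) := fun j => by abel
    rw [e j, e j', inner_add_left, inner_add_right, inner_add_right,
      real_inner_comm (meanVec (Pop p.1 (l j')) - meanVec (Pop p.1 (Fin.last m)))
        (X p.1 j p.2 - meanVec (Pop p.1 (l j)))]
    ring
  have := tendsto_finsetSum Finset.univ fun j (_ : j ∈ Finset.univ) =>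
    tendsto_finsetSum Finset.univ fun j' (_ : j' ∈ Finset.univ) => hjj j j'
  simp only [Finset.sum_const_zero] at this
  refine this.congr fun p => ?_
  simp_rw [← Finset.sum_div]

variable {ε : Fin (m + 1) → ℝ} {lam : (d : ℕ) → Fin d → ℝ} {h : (d : ℕ) → Fin d → Vec d}

/-- The normalized principal component scores concentrate on their class means. -/
lemma tendsto_score (hε : ∀ i, 0 < ε i) (hsum : ∑ i, ε i = 1)
    (hmom : ∀ d i, MemLp (fun x : Vec d => x) 2 (Pop d i))
    (hpos : ∀ᶠ d in atTop, 0 < minGap (Pop d)) (h2 : TraceSqCondition Pop)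
    (h5 : MeanStepCondition Pop)
    (hh : ∀ d, IsEigenDecomp (covMat (mixture ε (Pop d))) (lam d) (h d))
    (hsign : ∀ d (i : Fin m) (hi : (i : ℕ) < d), 0 ≤ ⟪h d ⟨i, hi⟩, stepVec (Pop d) i⟫)
    (hX : ∀ d j, Measurable (X d j)) (hmap : ∀ d j, (Q d).map (X d j) = Pop d (l j))
    (i : Fin m) (j : Fin n) :
    Tendsto (fun p : Σ d, Ω d => if hi : (i : ℕ) < p.1 then
      ⟪h p.1 ⟨i, hi⟩, X p.1 j p.2 - meanVec (mixture ε (Pop p.1))⟫ / √(lam p.1 ⟨i, hi⟩) else 0)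
      (probFilter Q) (𝓝 (weightedScore ε i (l j))) := by
  obtain ⟨e, he, heε⟩ : ∃ e, 0 < e ∧ ∀ i, e ≤ ε i := by
    obtain ⟨i0, -, hi0⟩ := Finset.exists_min_image Finset.univ ε ⟨0, Finset.mem_univ 0⟩
    exact ⟨ε i0, hε i0, fun i => hi0 i (Finset.mem_univ i)⟩
  have hm : 0 < (m : ℝ) := by exact_mod_cast i.pos
  set κ : ℝ := e / (8 * m ^ 2) with hκ
  have hκ0 : 0 < κ := by positivity
  let h' : (d : ℕ) → Vec d := fun d => if hi : (i : ℕ) < d then h d ⟨i, hi⟩ else 0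
  let lam' : ℕ → ℝ := fun d => if hi : (i : ℕ) < d then lam d ⟨i, hi⟩ else 0
  have hnoise : Tendsto (fun p : Σ d, Ω d =>
      ⟪h' p.1, X p.1 j p.2 - meanVec (Pop p.1 (l j))⟫ / √(lam' p.1)) (probFilter Q) (𝓝 0) := by
    refine tendsto_probFilter_of_sq (Q := Q) (b := fun d => √(lam' d))
      (f := fun d ω => ⟪h' d, X d j ω - meanVec (Pop d (l j))⟫)
      (V := fun d => √(⨆ i, (covMat (Pop d i) * covMat (Pop d i)).trace))
      (Eventually.of_forall fun d => integrable_sq_inner_obs (hX d j) (hmap d j) (hmom d _) _)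
      ?_ ?_
    · filter_upwards [eventually_gt_atTop (i : ℕ)] with d hd
      rw [integral_sq_inner_obs (hX d j) (hmap d j) (hmom d _)]
      refine (le_abs_self _).trans ((abs_dotProduct_covMat_le _ _ _).trans ?_)
      simp [h', hd, (hh d).orthonormal.1]
    · have hlim := (tendsto_sqrt_trace_div hpos h2).const_mul κ⁻¹
      rw [mul_zero] at hlim
      refine squeeze_zero' (Eventually.of_forall fun d => by positivity) ?_ hlim
      filter_upwards [eventually_gt_atTop (i : ℕ), hpos, eventually_nearlyOrthogonal hpos h5]
        with d hd hd0 hs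
      have hl := le_eigenvalue_mixture (fun i => (hε i).le) hsum (hmom d) hs (hh d) he heε i hd
      have hg : κ * minGap (Pop d) ≤ lam' d := by
        simp only [lam', hd, dite_true]
        exact le_trans (mul_le_mul_of_nonneg_left (minGap_le_norm_stepVec i) hκ0.le) hl
      have hκg : 0 < κ * minGap (Pop d) := by positivity
      rw [Real.sq_sqrt (hκg.le.trans hg)]
      calc _ ≤ √(⨆ i, (covMat (Pop d i) * covMat (Pop d i)).trace) / (κ * minGap (Pop d)) := by
            gcongr
        _ = _ := by field_simp
  have hpop := (tendsto_popScore hε hsum hmom hpos h2 h5 hh hsign i (l j)).comp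
    (tendsto_fst_probFilter (Q := Q))
  have := hpop.add hnoise
  rw [add_zero] at this
  refine this.congr fun p => ?_
  rw [Function.comp_apply, popScore]
  by_cases hi : (i : ℕ) < p.1
  · simp only [h', lam', hi, dite_true]
    rw [← add_div, ← inner_add_right]
    congr 2
    abel
  · simp [h', hi]

end Noise

section ClassFrequencies

variable {m n : ℕ} {l : Fin n → Fin (m + 1)}

lemma sum_classFreq_mul (l : Fin n → Fin (m + 1)) (φ : Fin (m + 1) → ℝ) :
    ∑ c, classFreq l c * φ c = (∑ j, φ (l j)) / n := by
  rw [Finset.sum_div, ← Finset.sum_fiberwise Finset.univ l]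
  refine Finset.sum_congr rfl fun c _ => ?_
  have : ∀ j ∈ Finset.univ.filter (fun j => l j = c), φ (l j) / (n : ℝ) = φ c / n := fun j hj => by
    rw [(Finset.mem_filter.1 hj).2]
  rw [Finset.sum_congr rfl this, Finset.sum_const, nsmul_eq_mul, classFreq, classCount]
  ring

lemma sum_classFreq (hn : 0 < n) (l : Fin n → Fin (m + 1)) : ∑ c, classFreq l c = 1 := by
  have := sum_classFreq_mul l fun _ => 1
  have hn' : (n : ℝ) ≠ 0 := by positivity
  simpa [hn'] using this

lemma surjective_of_classCount_pos (hl : ∀ i, 0 < classCount l i) : Function.Surjective l := by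
  intro c
  obtain ⟨j, hj⟩ := Finset.card_pos.1 (hl c)
  exact ⟨j, (Finset.mem_filter.1 hj).2⟩

end ClassFrequencies

section DualLimit

variable {m n : ℕ} {Pop : (d : ℕ) → Fin (m + 1) → Measure (Vec d)}
  [∀ d i, IsProbabilityMeasure (Pop d i)] {l : Fin n → Fin (m + 1)}
  {Ω : ℕ → Type*} [∀ d, MeasurableSpace (Ω d)] {Q : (d : ℕ) → Measure (Ω d)}
  [∀ d, IsProbabilityMeasure (Q d)] {X : (d : ℕ) → Fin n → Ω d → Vec d}
  {lamHat : (d : ℕ) → Ω d → Fin n → ℝ} {uHat : (d : ℕ) → Ω d → Fin n → Vec n}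

/-- The leading eigenvectors of the dual covariance matrix are asymptotically centred, constant on
the classes, and the `i`-th one is constant beyond class `i`. -/
lemma tendsto_dual_eigenvector_sub (hn : 2 ≤ n) (hl : Function.Surjective l)
    (hmom : ∀ d i, MemLp (fun x : Vec d => x) 2 (Pop d i))
    (hpos : ∀ᶠ d in atTop, 0 < minGap (Pop d)) (h2 : TraceSqCondition Pop)
    (h3 : NormVarianceCondition Pop) (h4 : TraceCondition Pop)
    (h5 : MeanStepCondition Pop) (h6 : StepVarianceCondition Pop)
    (hX : ∀ d j, Measurable (X d j)) (hmap : ∀ d j, (Q d).map (X d j) = Pop d (l j))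
    (hind : ∀ d, iIndepFun (X d) (Q d))
    (hu : ∀ d ω, IsEigenDecomp (dualCov fun j => X d j ω) (lamHat d ω) (uHat d ω))
    (i : Fin m) (hi : (i : ℕ) < n) :
    (∀ᶠ p : Σ d, Ω d in probFilter Q, ∑ j, uHat p.1 p.2 ⟨i, hi⟩ j = 0) ∧
    ∀ j j', (l j = l j' ∨ ∃ c, i < c ∧ l j = c.castSucc ∧ l j' = c.succ) →
      Tendsto (fun p : Σ d, Ω d => uHat p.1 p.2 ⟨i, hi⟩ j - uHat p.1 p.2 ⟨i, hi⟩ j')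
        (probFilter Q) (𝓝 0) := by
  have hm : 0 < (m : ℝ) := by exact_mod_cast i.pos
  have hgram := tendsto_gramError hmom hpos h2 h3 h4 h5 h6 hX hmap hind
  set η : (Σ d, Ω d) → ℝ := fun p => ∑ j, ∑ j', |gramError (fun j => X p.1 j p.2)
      (fun j => meanVec (Pop p.1 (l j)) - meanVec (Pop p.1 (Fin.last m)))
      (meanVec (Pop p.1 (Fin.last m))) (covMat (Pop p.1 0)).trace j j'| with hη
  have hη0 : ∀ p, 0 ≤ η p := fun p =>
    Finset.sum_nonneg fun _ _ => Finset.sum_nonneg fun _ _ => abs_nonneg _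
  have hσ : ∀ᶠ p : Σ d, Ω d in probFilter Q, 0 < minGap (Pop p.1) :=
    tendsto_fst_probFilter.eventually hpos
  have hηle : ∀ᶠ p : Σ d, Ω d in probFilter Q,
      η p ≤ 1 / (16 * (m : ℝ) ^ 2) * ‖stepVec (Pop p.1) i‖ ^ 2 := by
    filter_upwards [hgram.eventually
      (gt_mem_nhds (show 0 < 1 / (16 * (m : ℝ) ^ 2) by positivity)), hσ] with p hp hp0
    rw [div_lt_iff₀ hp0] at hp
    refine hp.le.trans ?_
    gcongr
    exact minGap_le_norm_stepVec i
  have hmain : ∀ᶠ p : Σ d, Ω d in probFilter Q, ∑ j, uHat p.1 p.2 ⟨i, hi⟩ j = 0 ∧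
      ∀ j j', |uHat p.1 p.2 ⟨i, hi⟩ j - uHat p.1 p.2 ⟨i, hi⟩ j'| ≤
        32 * (m : ℝ) ^ 2 * (‖meanVec (Pop p.1 (l j)) - meanVec (Pop p.1 (l j'))‖ /
          ‖stepVec (Pop p.1) i‖ + η p / ‖stepVec (Pop p.1) i‖ ^ 2) := by
    filter_upwards [hηle, tendsto_fst_probFilter.eventually (eventually_nearlyOrthogonal hpos h5)]
      with p hp hs
    exact abs_eigenvector_sub_le (μ := fun c => meanVec (Pop p.1 c)) hn hl hs (hu p.1 p.2)
      (trace_covMat_nonneg (hmom p.1 0)) i hi hp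
  refine ⟨hmain.mono fun p hp => hp.1, fun j j' hjj => ?_⟩
  have hη' : Tendsto (fun p => η p / ‖stepVec (Pop p.1) i‖ ^ 2) (probFilter Q) (𝓝 0) := by
    refine squeeze_zero' (Eventually.of_forall fun p => div_nonneg (hη0 p) (sq_nonneg _)) ?_ hgram
    filter_upwards [hσ] with p hp
    exact div_le_div_of_nonneg_left (hη0 p) hp (minGap_le_norm_stepVec i)
  have hmean : Tendsto (fun d => ‖meanVec (Pop d (l j)) - meanVec (Pop d (l j'))‖ /
      ‖stepVec (Pop d) i‖) atTop (𝓝 0) := by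
    rcases hjj with h | ⟨c, hic, h, h'⟩
    · simp [h]
    · have hr := (h5 i c hic).2.sqrt
      rw [Real.sqrt_zero] at hr
      refine hr.congr fun d => ?_
      rw [h, h', meanGap, meanGap, Real.sqrt_div (sq_nonneg _), Real.sqrt_sq (norm_nonneg _),
        Real.sqrt_sq (norm_nonneg _)]
      rfl
  have hlim := ((hmean.comp (tendsto_fst_probFilter (Q := Q))).add hη').const_mul
    (32 * (m : ℝ) ^ 2)
  rw [add_zero, mul_zero] at hlim
  exact squeeze_zero_norm' (hmain.mono fun p hp => hp.2 j j') hlim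

end DualLimit

theorem theorem3
    -- the number of classes is `k = m + 1 ≥ 2`; the sample size is `n ≥ k`
    (m n : ℕ) (hm : 1 ≤ m) (hn : m + 1 ≤ n)
    -- mixing proportions, independent of `d`
    (ε : Fin (m + 1) → ℝ) (hε : ∀ i, ε i ∈ Set.Ioo (0 : ℝ) 1) (hεsum : ∑ i, ε i = 1)
    -- the populations in each dimension `d`, with finite second moments
    (Pop : (d : ℕ) → Fin (m + 1) → Measure (Vec d))
    (hPop : ∀ d i, IsProbabilityMeasure (Pop d i))
    (hmom : ∀ d i, MemLp (fun x : Vec d => x) 2 (Pop d i))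
    -- the mean vectors are distinct for large `d`
    (hpos : ∀ᶠ d in atTop, 0 < minGap (Pop d))
    (h2 : TraceSqCondition Pop) (h3 : NormVarianceCondition Pop) (h4 : TraceCondition Pop)
    (h5 : MeanStepCondition Pop) (h6 : StepVarianceCondition Pop)
    -- the labelled sample in each dimension
    (Ω : ℕ → Type*) [∀ d, MeasurableSpace (Ω d)] (P : (d : ℕ) → Measure (Ω d))
    [∀ d, IsProbabilityMeasure (P d)]
    (Y : (d : ℕ) → Fin n → Ω d → Fin (m + 1)) (X : (d : ℕ) → Fin n → Ω d → Vec d)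
    (hX : ∀ d, IsMixtureSample (P d) ε (Pop d) (Y d) (X d))
    -- eigen-decomposition of the covariance matrix of the mixture, and its sign convention
    (lam : (d : ℕ) → Fin d → ℝ) (h : (d : ℕ) → Fin d → Vec d)
    (hh : ∀ d, IsEigenDecomp (covMat (mixture ε (Pop d))) (lam d) (h d))
    (hsign : ∀ d (i : Fin m) (hi : (i : ℕ) < d), 0 ≤ ⟪h d ⟨i, hi⟩, stepVec (Pop d) i⟫)
    -- eigen-decomposition of the dual sample covariance matrix, and its sign convention
    -- `0 ≤ ûᵢᵀ zᵢ`, where `zᵢⱼ = hᵢᵀ (xⱼ - μ) / √λᵢ`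
    (lamHat : (d : ℕ) → Ω d → Fin n → ℝ) (uHat : (d : ℕ) → Ω d → Fin n → Vec n)
    (hu : ∀ d ω, IsEigenDecomp (dualCov fun j => X d j ω) (lamHat d ω) (uHat d ω))
    (husign : ∀ d ω (i : Fin m) (hi : (i : ℕ) < d),
      0 ≤ ∑ j, uHat d ω (Fin.castLE (by omega) i) j *
        (⟪h d ⟨i, hi⟩, X d j ω - meanVec (mixture ε (Pop d))⟫ / √(lam d ⟨i, hi⟩))) :
    -- given any assignment `l` of labels in which every class occurs, the normalized scores
    -- converge in probability
    ∀ l : Fin n → Fin (m + 1), (∀ i, 0 < classCount l i) →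
      ∀ (i : Fin m) (j : Fin n) (τ : ℝ), 0 < τ →
        Tendsto
          (fun d => (P d)[|{ω | ∀ j', Y d j' ω = l j'}]
            {ω | τ ≤ |√n * uHat d ω (Fin.castLE (by omega) i) j - scoreLimit l i (l j)|})
          atTop (𝓝 0) := by
  intro l hl i j
  have hε0 : ∀ i, 0 < ε i := fun i => (hε i).1
  have hn0 : (0 : ℝ) < n := by
    have : 0 < n := by omega
    exact_mod_cast this
  have hprob := fun d => (hX d).isProbabilityMeasure_cond hε0 l
  have hmap := fun d => (hX d).map_cond_apply hε0 l
  have hind := fun d => (hX d).iIndepFun_cond hε0 l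
  have hmeas := fun d => (hX d).measurable_obs
  have hsurj := surjective_of_classCount_pos hl
  set Q : (d : ℕ) → Measure (Ω d) := fun d => (P d)[|{ω | ∀ j', Y d j' ω = l j'}]
  have hdual := fun i : Fin m => tendsto_dual_eigenvector_sub (Q := Q) (by omega) hsurj hmom hpos
    h2 h3 h4 h5 h6 hmeas hmap hind hu i (i.2.trans (by omega))
  have hscore := tendsto_score (Q := Q) hε0 hεsum hmom hpos h2 h5 hh hsign hmeas hmap
  refine (tendsto_probFilter_iff (Q := Q)
    (f := fun p => √n * uHat p.1 p.2 (Fin.castLE (by omega) i) j)).1 ?_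
  rw [tendsto_iff_ultrafilter]
  intro U hU
  have hbound : ∀ (i : Fin m) (j : Fin n), ∃ x,
      Tendsto (fun p : Σ d, Ω d => uHat p.1 p.2 ⟨i, i.2.trans (by omega)⟩ j) U (𝓝 x) := by
    intro i j
    refine U.exists_tendsto_of_abs_le (B := 1) (Eventually.of_forall fun p => ?_)
    have := PiLp.norm_apply_le (uHat p.1 p.2 ⟨i, i.2.trans (by omega)⟩) j
    rwa [(hu p.1 p.2).orthonormal.1, Real.norm_eq_abs] at this
  choose v hv using hbound
  have heq : ∀ (i : Fin m) j j', (l j = l j' ∨ ∃ c, i < c ∧ l j = c.castSucc ∧ l j' = c.succ) →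
      v i j = v i j' := fun i j j' hjj =>
    sub_eq_zero.1 (tendsto_nhds_unique ((hv i j).sub (hv i j'))
      (((hdual i).2 j j' hjj).mono_left hU))
  choose rep hrep using hsurj
  have hvrep : ∀ i j, v i j = v i (rep (l j)) := fun i j => heq i _ _ (Or.inl (hrep _).symm)
  have hsq : √(n : ℝ) * √n = n := Real.mul_self_sqrt hn0.le
  have hw : ∀ c, 0 < classFreq l c := fun c => div_pos (by exact_mod_cast hl c) hn0
  have hwsum : ∑ c, classFreq l c = 1 := sum_classFreq (by omega) l
  have hcore := eq_or_eq_neg_weightedScore hw hwsum (g := fun i c => √n * v i (rep c))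
    (fun i i' => by
      have h1 : ∑ j, v i j * v i' j = if i = i' then 1 else 0 := by
        refine tendsto_nhds_unique
          (tendsto_finsetSum _ fun j _ => (hv i j).mul (hv i' j))
          (tendsto_const_nhds.congr fun p => ?_)
        have := orthonormal_iff_ite.1 (hu p.1 p.2).orthonormal ⟨i, i.2.trans (by omega)⟩
          ⟨i', i'.2.trans (by omega)⟩
        rw [inner_eq_sum_mul] at this
        rw [this]
        simp [Fin.ext_iff]
      have h7 := sum_classFreq_mul l fun c => √n * v i (rep c) * (√n * v i' (rep c))
      simp_rw [← mul_assoc] at h7 ⊢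
      rw [h7, ← h1, Finset.sum_div]
      refine Finset.sum_congr rfl fun j _ => ?_
      rw [← hvrep, ← hvrep, div_eq_iff hn0.ne']
      linear_combination v i j * v i' j * hsq)
    (fun i => by
      have h1 : ∑ j, v i j = 0 := by
        refine tendsto_nhds_unique (tendsto_finsetSum _ fun j _ => hv i j)
          (tendsto_const_nhds.congr' ?_)
        filter_upwards [hU (hdual i).1] with p hp
        exact hp.symm
      rw [sum_classFreq_mul]
      simp_rw [← hvrep]
      rw [← Finset.mul_sum, h1, mul_zero, zero_div])
    (fun i c hic => by
      rw [heq i (rep c.castSucc) (rep c.succ) (Or.inr ⟨c, hic, hrep _, hrep _⟩)]) i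
  have hlim : Tendsto (fun p : Σ d, Ω d => √n * uHat p.1 p.2 (Fin.castLE (by omega) i) j) U
      (𝓝 (√n * v i j)) := (hv i j).const_mul _
  suffices hgoal : √n * v i j = weightedScore (classFreq l) i (l j) by
    rw [hgoal] at hlim
    exact hlim
  rcases hcore with hc | hc
  · rw [hvrep]
    exact hc (l j)
  · exfalso
    have h7 : 0 ≤ ∑ j, v i j * weightedScore ε i (l j) := by
      refine ge_of_tendsto (tendsto_finsetSum _ fun j _ =>
        (hv i j).mul ((hscore i j).mono_left hU)) ?_
      filter_upwards [hU (tendsto_fst_probFilter.eventually (eventually_gt_atTop (i : ℕ)))]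
        with p hp
      simp only [hp, dite_true]
      exact husign p.1 p.2 i hp
    have h8 : ∑ j, weightedScore (classFreq l) i (l j) * weightedScore ε i (l j) =
        -(√n * ∑ j, v i j * weightedScore ε i (l j)) := by
      rw [Finset.mul_sum, ← Finset.sum_neg_distrib]
      refine Finset.sum_congr rfl fun j _ => ?_
      have := hc (l j)
      rw [← hvrep] at this
      linear_combination weightedScore ε i (l j) * this
    have h9 : 0 < ∑ j, weightedScore (classFreq l) i (l j) * weightedScore ε i (l j) := by
      refine Finset.sum_pos' (fun j _ => ?_) ⟨rep i.castSucc, Finset.mem_univ _, ?_⟩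
      · rcases eq_or_ne (l j) i.castSucc with hj | hj
        · rw [hj]
          exact (mul_pos (weightedScore_castSucc_pos hw hwsum i)
            (weightedScore_castSucc_pos hε0 hεsum i)).le
        · exact mul_nonneg_of_nonpos_of_nonpos (weightedScore_nonpos _ _ _ hj)
            (weightedScore_nonpos _ _ _ hj)
      · rw [hrep]
        exact mul_pos (weightedScore_castSucc_pos hw hwsum i)
          (weightedScore_castSucc_pos hε0 hεsum i)
    have h10 := mul_nonneg (Real.sqrt_nonneg (n : ℝ)) h7
    linarith
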